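/- Let $\mathfrak g$ be a finite-dimensional simple Lie algebra over $\mathbb C$ with Killing form $\langle\cdot,\cdot\rangle$, $\mathfrak h$ a Cartan subalgebra, $\mathfrak g=\mathfrak h\oplus\bigoplus_{\alpha\in\Delta}\mathfrak g_\alpha$ the root decomposition, and fix simple roots and the corresponding set $\Delta_+$ of positive roots. Identify $\mathfrak h^*$ with $\mathfrak h$ by the Killing form and let $U\subset\mathfrak h^*\cong\mathfrak h$ be a connected open subset. Consider the trivial holomorphic bundle $$E=(TU\oplus T^*U)\times(\mathfrak g\oplus\mathfrak g)\cong U\times(\mathfrak h\oplus\mathfrak h\oplus\mathfrak g\oplus\mathfrak g),$$ where $(\xi,\eta;X,Y)$ consists of the tangent vector $\xi$, the cotangent vector $\langle\eta,\cdot\rangle$ and $(X,Y)\in\mathfrak g\oplus\mathfrak g$, with the inner product $$\big((\xi_1,\eta_1;X_1,Y_1),(\xi_2,\eta_2;X_2,Y_2)\big)=\tfrac12\big(\langle\xi_1,\eta_2\rangle+\langle\eta_1,\xi_2\rangle\big)+\tfrac14\big(\langle Y_1,Y_2\rangle-\langle X_1,X_2\rangle\big)$$ and the Courant bracket of holomorphic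 sections $s_i=(\xi_i,\eta_i;X_i,Y_i)$ $$[s_1,s_2]=\partial_{\xi_1}s_2-\partial_{\xi_2}s_1+(0,\omega;[X_1,X_2],[Y_1,Y_2]),\qquad \langle\omega,v\rangle=(\partial_v s_1,s_2)-(s_1,\partial_v s_2)\quad(v\in\mathfrak h),$$ where $\partial_v$ is the derivative of vector-valued functions on $U$ in the direction $v$. (On $TU\oplus T^*U$ this is Courant's original bracket, and on constant sections it is the bracket of $\mathfrak g\oplus\mathfrak g$.) A Dirac structure is a holomorphic subbundle $L\subset E$ that is maximally isotropic and whose holomorphic sections over $U$ are closed under the bracket. Let $S$ be a set of simple roots, let $[S]\subset\Delta_+$ be the set of positive roots that are combinations of elements of $S$ with non-negative integer coefficients, and put $$\mathfrak n^\circ_\pm=\bigoplus_{\alpha\in[S]}\mathfrak g_{\pm\alpha},\qquad \mathfrak k_\pm=\bigoplus_{\alpha\in\Delta_+\setminus[S]}\mathfrak g_{\pm\alpha}.$$ For each $\lambda\in U$ let $\varphi(\lambda)$ be a linear operator on $\mathfrak n^\circ_+\oplus\mathfrak n^\circ_-$, and let $L(\lambda)\subset E_\lambda$ be the span of $d=\{(k,h;h+k,h-k)\mid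 h,k\in\mathfrak h\}$, of the vectors $(0,0;X,\varphi(\lambda)X)$ with $X\in\mathfrak n^\circ_+\oplus\mathfrak n^\circ_-$, and of the vectors $(0,0;Y_-,Y_+)$ with $Y_\pm\in\mathfrak k_\pm$. **Theorem 4.5.** $L=\bigcup_{\lambda\in U}L(\lambda)$ is a Dirac structure of the Courant algebroid $E$ if and only if there is a $\lambda_0\in\mathfrak h$ such that, for all $\lambda\in U$, $\varphi(\lambda)$ is the restriction to $\mathfrak n^\circ_+\oplus\mathfrak n^\circ_-$ of $$\mathrm{Ad}_{e^{2(\lambda+\lambda_0)}}=\exp\big(\mathrm{ad}_{2(\lambda+\lambda_0)}\big)=\sum_{n\ge0}\frac{1}{n!}\big(\mathrm{ad}_{2(\lambda+\lambda_0)}\big)^n.$$ -/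

import Mathlib

open LieAlgebra LieAlgebra.IsKilling

namespace DiracTriangular

noncomputable section

/-! ### Sums of root spaces attached to a set of simple roots -/

section Roots

variable {𝔤 : Type*} [LieRing 𝔤] [LieAlgebra ℂ 𝔤] [FiniteDimensional ℂ 𝔤] [LieAlgebra.IsSimple ℂ 𝔤]
  {H : LieSubalgebra ℂ 𝔤} [H.IsCartanSubalgebra]

/-- `[S]`: the positive roots (relative to the base `b`) that are combinations, with coefficients
in `ℕ`, of the elements of `S`. -/
def spannedRoots (b : (rootSystem H).Base) (S : Set H.root) : Set H.root :=
  {α | b.IsPos α ∧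
    (rootSystem H).root α ∈ AddSubmonoid.closure ((rootSystem H).root '' S)}

/-- `𝔫°₊`: the sum of the root spaces `𝔤_α`, `α ∈ [S]`. -/
def nPos (b : (rootSystem H).Base) (S : Set H.root) : Submodule ℂ 𝔤 :=
  ⨆ α ∈ spannedRoots b S, (rootSpace H (α : LieModule.Weight ℂ H 𝔤)).toSubmodule

/-- `𝔫°₋`: the sum of the root spaces `𝔤_{-α}`, `α ∈ [S]`. -/
def nNeg (b : (rootSystem H).Base) (S : Set H.root) : Submodule ℂ 𝔤 :=
  ⨆ α ∈ spannedRoots b S, (rootSpace H (-⇑(α : LieModule.Weight ℂ H 𝔤))).toSubmodule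

/-- `𝔨₊`: the sum of the root spaces `𝔤_α`, `α` a positive root outside `[S]`. -/
def kPos (b : (rootSystem H).Base) (S : Set H.root) : Submodule ℂ 𝔤 :=
  ⨆ α ∈ {α | b.IsPos α} \ spannedRoots b S,
    (rootSpace H (α : LieModule.Weight ℂ H 𝔤)).toSubmodule

/-- `𝔨₋`: the sum of the root spaces `𝔤_{-α}`, `α` a positive root outside `[S]`. -/
def kNeg (b : (rootSystem H).Base) (S : Set H.root) : Submodule ℂ 𝔤 :=
  ⨆ α ∈ {α | b.IsPos α} \ spannedRoots b S,
    (rootSpace H (-⇑(α : LieModule.Weight ℂ H 𝔤))).toSubmodule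

end Roots

/-! ### The Courant algebroid `E = (TU ⊕ T*U) × (𝔤 ⊕ 𝔤)`

The dual `𝔥*` is identified with `𝔥` by the Killing form, so that `U ⊆ 𝔥`, both `TU` and `T*U`
are `U × 𝔥`, and `E` is the trivial bundle over `U` with fibre `𝔥 × 𝔥 × 𝔤 × 𝔤`.
A vector `(ξ, η, X, Y)` of the fibre consists of a tangent vector `ξ`, of the cotangent vector
`v ↦ ⟨η, v⟩` and of `(X, Y) ∈ 𝔤 ⊕ 𝔤`. Sections are functions on `U`, represented by functions
on `𝔥` of which only the values on `U` matter. -/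

section Courant

variable {𝔤 : Type*} [LieRing 𝔤] [LieAlgebra ℂ 𝔤]

/-- The fibre `𝔥 × 𝔥 × 𝔤 × 𝔤` of `E`. -/
abbrev Fiber (H : LieSubalgebra ℂ 𝔤) : Type _ := H × H × 𝔤 × 𝔤

/-- The inner product on the fibres of `E`:
`½ (⟨ξ₁, η₂⟩ + ⟨η₁, ξ₂⟩) + ¼ (⟨Y₁, Y₂⟩ - ⟨X₁, X₂⟩)`, where `⟨·,·⟩` is the Killing form of `𝔤`. -/
def pairing (H : LieSubalgebra ℂ 𝔤) : LinearMap.BilinForm ℂ (Fiber H) :=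
  LinearMap.mk₂ ℂ
    (fun u v =>
      (1 / 2 : ℂ) * (killingForm ℂ 𝔤 u.1 v.2.1 + killingForm ℂ 𝔤 u.2.1 v.1) +
      (1 / 4 : ℂ) * (killingForm ℂ 𝔤 u.2.2.2 v.2.2.2 - killingForm ℂ 𝔤 u.2.2.1 v.2.2.1))
    (by intro u u' v; simp; ring)
    (by intro c u v; simp; ring)
    (by intro u v v'; simp; ring)
    (by intro c u v; simp; ring)

variable [FiniteDimensional ℂ 𝔤] [LieAlgebra.IsSimple ℂ 𝔤] {H : LieSubalgebra ℂ 𝔤}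
  [H.IsCartanSubalgebra] [TopologicalSpace 𝔤]

/-- The Courant bracket of two sections `s = (ξ₁, η₁; X₁, Y₁)` and `t = (ξ₂, η₂; X₂, Y₂)`:
`∂_{ξ₁} t - ∂_{ξ₂} s + (0, ω; [X₁, X₂], [Y₁, Y₂])`, where `∂` is the derivative of functions on `U`
and `ω` is the one-form `v ↦ (∂_v s, t) - (s, ∂_v t)`, turned into an `𝔥`-valued function by the
Killing form.

On constant sections this is `(0, 0; [X₁, X₂], [Y₁, Y₂])`; on sections of `TU ⊕ T*U` it is the
bracket `[ξ₁, ξ₂] + L_{ξ₁} η₂ - L_{ξ₂} η₁ + ½ d (⟨η₁, ξ₂⟩ - ⟨η₂, ξ₁⟩)` of Courant (expand the Lie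
derivatives as `(L_ξ η)(v) = ⟨∂_ξ η, v⟩ + ⟨η, ∂_v ξ⟩`); for a vector field `ξ` and `e ∈ 𝔤 ⊕ 𝔤`,
`[ξ, f e] = (∂_ξ f) e`; and `[s, f t] = f [s, t] + (∂_{ξ₁} f) t - (s, t) df`. -/
def courantBracket (s t : H → Fiber H) : H → Fiber H := fun μ =>
  fderiv ℂ t μ (s μ).1 - fderiv ℂ s μ (t μ).1 +
    (0,
      (cartanEquivDual H).symm
        ((pairing H).flip (t μ) ∘ₗ (fderiv ℂ s μ : H →ₗ[ℂ] Fiber H) -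
          pairing H (s μ) ∘ₗ (fderiv ℂ t μ : H →ₗ[ℂ] Fiber H)),
      ⁅(s μ).2.2.1, (t μ).2.2.1⁆, ⁅(s μ).2.2.2, (t μ).2.2.2⁆)

/-- A subspace of the fibre on which the inner product vanishes. -/
def IsIsotropic (W : Submodule ℂ (Fiber H)) : Prop :=
  ∀ u ∈ W, ∀ v ∈ W, pairing H u v = 0

/-- The family `L` of subspaces is a holomorphic subbundle of `E` over `U`: near every point of `U`
it has a frame of holomorphic sections. -/
def IsHolomorphicSubbundle (U : Set H) (L : H → Submodule ℂ (Fiber H)) : Prop :=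
  ∀ μ ∈ U, ∃ V : Set H, IsOpen V ∧ μ ∈ V ∧ V ⊆ U ∧
    ∃ (r : ℕ) (e : Fin r → H → Fiber H), (∀ i, DifferentiableOn ℂ (e i) V) ∧
      ∀ ν ∈ V, LinearIndependent ℂ (fun i => e i ν) ∧
        Submodule.span ℂ (Set.range fun i => e i ν) = L ν

/-- `s` is a holomorphic section of `L` over `U`. -/
def IsSection (U : Set H) (L : H → Submodule ℂ (Fiber H)) (s : H → Fiber H) : Prop :=
  DifferentiableOn ℂ s U ∧ ∀ μ ∈ U, s μ ∈ L μ

/-- A Dirac structure of `E` over `U`: a holomorphic subbundle that is maximally isotropic and whose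
sections are closed under the Courant bracket. (The bracket of holomorphic sections of `E` is again
holomorphic, so closedness only asks that its values lie in `L`.) -/
structure IsDirac (U : Set H) (L : H → Submodule ℂ (Fiber H)) : Prop where
  subbundle : IsHolomorphicSubbundle U L
  maximal_isotropic : ∀ μ ∈ U, Maximal IsIsotropic (L μ)
  bracket_closed : ∀ s t, IsSection U L s → IsSection U L t → ∀ μ ∈ U, courantBracket s t μ ∈ L μ

end Courant

section Family

variable {𝔤 : Type*} [LieRing 𝔤] [LieAlgebra ℂ 𝔤] [FiniteDimensional ℂ 𝔤] [LieAlgebra.IsSimple ℂ 𝔤]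
  {H : LieSubalgebra ℂ 𝔤} [H.IsCartanSubalgebra]

/-- The family `L(μ)` attached to operators `φ(μ)` on `𝔫°₊ ⊕ 𝔫°₋`: it is spanned by
`d = {(k, h; h + k, h - k) | h, k ∈ 𝔥}`, the vectors `(0, 0; X, φ(μ) X)` with `X ∈ 𝔫°₊ ⊕ 𝔫°₋`, and
the vectors `(0, 0; Y₋, Y₊)` with `Y₋ ∈ 𝔨₋` and `Y₊ ∈ 𝔨₊`. -/
def family (b : (rootSystem H).Base) (S : Set H.root)
    (φ : H → Module.End ℂ ↥(nPos b S ⊔ nNeg b S)) (μ : H) : Submodule ℂ (Fiber H) :=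
  Submodule.span ℂ
    ({u | ∃ h k : H, u = (k, h, (h : 𝔤) + k, (h : 𝔤) - k)} ∪
      {u | ∃ X : ↥(nPos b S ⊔ nNeg b S), u = (0, 0, (X : 𝔤), (φ μ X : 𝔤))} ∪
      {u | ∃ Ym ∈ kNeg b S, ∃ Yp ∈ kPos b S, u = (0, 0, Ym, Yp)})

end Family

end

end DiracTriangular

set_option linter.unusedSectionVars false

/-! Choose `g` in the Cartan subalgebra on which the simple roots of `S` take the value 0 and the
other simple roots the value 1. The real part of `χ g` grades `𝔤`: `𝔫°₊ ⊕ 𝔫°₋` is the sum of the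
root spaces of degree 0, and `𝔨₊`, `𝔨₋` have positive and negative degree. So `L(μ)` is governed by
two opposite parabolic subalgebras with a common Levi factor.

Sufficiency. Let `φ(μ) = Ad e^{2(μ+μ₀)}`. Applying the inverse of this automorphism to the last
component turns `L(μ)` into a space `modelSpace g` independent of `μ`: `X` lies in the nonpositive
parabolic, `Y + 2ξ` in the nonnegative one, their Levi parts agree, and their common Cartan part is
`η + ξ`. On a parabolic the Killing form depends only on Levi parts, and projection to the Levi
factor is a Lie homomorphism; hence the model is isotropic and closed under the algebraic part of
the bracket. It is also its own orthogonal, so maximal. Differentiating the moving automorphism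
produces the terms `2[ξ, Y]` that turn `[Y₁, Y₂]` into `[Y₁ + 2ξ₁, Y₂ + 2ξ₂]`, and isotropy computes
the one-form `ω` (`modelFamily_bracket_mem`).

Necessity. The bracket of the constant section `(k, h; h+k, h-k)` with `(0, 0; X, φX)` gives `φ[h+k,
X] = ∂_k φX + [h-k, φX]`. For `k = 0`, `φ` commutes with the Cartan subalgebra; for `h = 0`, `∂_k φX
= 2[k, φX]`, so `Ad e^{-2μ} φ(μ)` is constant on the connected set `U`. At one point `φ` is scalar
on each root space, multiplicative on brackets and isometric, which makes it some `Ad e^h`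
(`IsLeviAutomorphism.exists_eq_torus`). -/

namespace DiracTriangular

noncomputable section

/-! ### Operators acting by a scalar on each root space. -/

section WeightMultiplier

variable {𝔤 : Type*} [LieRing 𝔤] [LieAlgebra ℂ 𝔤] [FiniteDimensional ℂ 𝔤] [LieAlgebra.IsSimple ℂ 𝔤]
  (H : LieSubalgebra ℂ 𝔤) [H.IsCartanSubalgebra]

open scoped Classical in
theorem exists_weightProj : ∃ π : LieModule.Weight ℂ H 𝔤 → Module.End ℂ 𝔤,
    ∀ χ ψ : LieModule.Weight ℂ H 𝔤, ∀ x ∈ rootSpace H ψ, π χ x = if ψ = χ then x else 0 := by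
  classical
  have hds := DirectSum.isInternal_submodule_of_iSupIndep_of_iSup_eq_top
    (A := fun χ : LieModule.Weight ℂ H 𝔤 => (rootSpace H χ).toSubmodule)
    (LieSubmodule.iSupIndep_toSubmodule.mpr (LieModule.iSupIndep_genWeightSpace' ℂ H 𝔤))
    (by rw [← LieSubmodule.iSup_toSubmodule, LieModule.iSup_genWeightSpace_eq_top' ℂ H 𝔤]; rfl)
  let e := LinearEquiv.ofBijective (DirectSum.coeLinearMap
    (fun χ : LieModule.Weight ℂ H 𝔤 => (rootSpace H χ).toSubmodule)) hds
  refine ⟨fun χ => (rootSpace H χ).toSubmodule.subtype ∘ₗ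
    DirectSum.component ℂ _ _ χ ∘ₗ e.symm.toLinearMap, fun χ ψ x hx => ?_⟩
  have h1 : e.symm x = DirectSum.lof ℂ _
      (fun χ : LieModule.Weight ℂ H 𝔤 => (rootSpace H χ).toSubmodule) ψ ⟨x, hx⟩ := by
    rw [LinearEquiv.symm_apply_eq]
    exact (DirectSum.coeLinearMap_lof (fun χ : LieModule.Weight ℂ H 𝔤 => (rootSpace H χ).toSubmodule)
      ψ ⟨x, hx⟩).symm
  simp only [LinearMap.comp_apply, LinearEquiv.coe_coe, h1]
  rw [DirectSum.component.of]
  split_ifs with h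
  · subst h; rfl
  · rfl

/-- The projections of `𝔤` onto its root spaces. -/
def weightProj (χ : LieModule.Weight ℂ H 𝔤) : Module.End ℂ 𝔤 :=
  (exists_weightProj H).choose χ

open scoped Classical in
theorem weightProj_apply (χ ψ : LieModule.Weight ℂ H 𝔤) {x : 𝔤} (hx : x ∈ rootSpace H ψ) :
    weightProj H χ x = if ψ = χ then x else 0 :=
  (exists_weightProj H).choose_spec χ ψ x hx

/-- The operator on `𝔤` that acts on the root space of `χ` as the scalar `f χ`. -/
def weightMul (f : (H → ℂ) → ℂ) : Module.End ℂ 𝔤 :=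
  ∑ χ : LieModule.Weight ℂ H 𝔤, f χ • weightProj H χ

variable {H}

/-- Here `χ` may be any function, since non-weights have zero root space. Identities between
multipliers thereby reduce to pointwise identities between scalar functions, with no check that `χ +
ψ` or `-χ` is a weight. -/
theorem weightMul_apply_of_mem (f : (H → ℂ) → ℂ) {χ : H → ℂ} {x : 𝔤} (hx : x ∈ rootSpace H χ) :
    weightMul H f x = f χ • x := by
  by_cases h : rootSpace H χ = ⊥
  · rw [h, LieSubmodule.mem_bot] at hx
    simp [hx]
  · let ψ : LieModule.Weight ℂ H 𝔤 := ⟨χ, h⟩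
    have hx' : x ∈ rootSpace H ψ := hx
    simp only [weightMul, LinearMap.sum_apply, LinearMap.smul_apply]
    rw [Finset.sum_eq_single ψ]
    · rw [weightProj_apply H ψ ψ hx', if_pos rfl]
      rfl
    · intro φ _ hφ
      rw [weightProj_apply H φ ψ hx', if_neg (Ne.symm hφ), smul_zero]
    · simp

theorem rootSpace_induction {p : 𝔤 → Prop}
    (h : ∀ χ : H → ℂ, ∀ x ∈ rootSpace H χ, p x)
    (h_add : ∀ x y, p x → p y → p (x + y)) (x : 𝔤) : p x := by
  have hx : x ∈ ⨆ χ : LieModule.Weight ℂ H 𝔤, (rootSpace H χ).toSubmodule := by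
    rw [← LieSubmodule.iSup_toSubmodule, LieModule.iSup_genWeightSpace_eq_top' ℂ H 𝔤]
    trivial
  induction hx using Submodule.iSup_induction' with
  | mem χ x hx => exact h χ x hx
  | zero => exact h 0 0 (zero_mem _)
  | add x y _ _ hx hy => exact h_add x y hx hy

theorem weightMul_mul_apply (f g : (H → ℂ) → ℂ) (x : 𝔤) :
    weightMul H f (weightMul H g x) = weightMul H (fun χ => f χ * g χ) x := by
  induction x using rootSpace_induction (H := H) with
  | h χ x hx => simp [weightMul_apply_of_mem _ hx, smul_smul, mul_comm]
  | h_add x y hx hy => simp [hx, hy]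

theorem weightMul_one (x : 𝔤) : weightMul H (fun _ => 1) x = x := by
  induction x using rootSpace_induction (H := H) with
  | h χ x hx => simp [weightMul_apply_of_mem _ hx]
  | h_add x y hx hy => simp [hx, hy]

theorem weightMul_zero (x : 𝔤) : weightMul H (fun _ => 0) x = 0 := by
  simp [weightMul]

theorem weightMul_add_apply (f g : (H → ℂ) → ℂ) (x : 𝔤) :
    weightMul H (fun χ => f χ + g χ) x = weightMul H f x + weightMul H g x := by
  simp [weightMul, add_smul, Finset.sum_add_distrib]

theorem weightMul_eval (h : H) (x : 𝔤) : weightMul H (fun χ => χ h) x = ⁅(h : 𝔤), x⁆ := by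
  induction x using rootSpace_induction (H := H) with
  | h χ x hx =>
    rw [weightMul_apply_of_mem _ hx, ← lie_eq_smul_of_mem_rootSpace hx h]
    rfl
  | h_add x y hx hy => simp [hx, hy]

/-- Weight multipliers and the Lie bracket. -/
theorem weightMul_lie {f f' g g' k : (H → ℂ) → ℂ}
    (h : ∀ χ ψ, k (χ + ψ) * f χ * g ψ = f' χ * g' ψ) (x y : 𝔤) :
    weightMul H k ⁅weightMul H f x, weightMul H g y⁆ = ⁅weightMul H f' x, weightMul H g' y⁆ := by
  induction x using rootSpace_induction (H := H) with
  | h χ x hx =>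
    induction y using rootSpace_induction (H := H) with
    | h ψ y hy =>
      simp only [weightMul_apply_of_mem _ hx, weightMul_apply_of_mem _ hy, smul_lie, lie_smul,
        map_smul, weightMul_apply_of_mem _ (lie_mem_genWeightSpace_of_mem_genWeightSpace hx hy),
        smul_smul]
      congr 1
      linear_combination h χ ψ
    | h_add y z hy hz => simp [hy, hz]
  | h_add x z hx hz => simp [hx, hz]

/-- Weight multipliers and the Killing form. -/
theorem killingForm_weightMul {f f' g g' : (H → ℂ) → ℂ}
    (h : ∀ χ, f χ * g (-χ) = f' χ * g' (-χ)) (x y : 𝔤) :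
    killingForm ℂ 𝔤 (weightMul H f x) (weightMul H g y) =
      killingForm ℂ 𝔤 (weightMul H f' x) (weightMul H g' y) := by
  induction x using rootSpace_induction (H := H) with
  | h χ x hx =>
    induction y using rootSpace_induction (H := H) with
    | h ψ y hy =>
      simp only [weightMul_apply_of_mem _ hx, weightMul_apply_of_mem _ hy, map_smul,
        LinearMap.smul_apply, smul_eq_mul]
      by_cases hχ : (χ : H → ℂ) + ψ = 0
      · rw [← neg_eq_of_add_eq_zero_right hχ]
        linear_combination (h χ) * killingForm ℂ 𝔤 x y
      · rw [killingForm_apply_eq_zero_of_mem_rootSpace_of_add_ne_zero ℂ 𝔤 H hx hy hχ]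
        ring
    | h_add y z hy hz => simp only [map_add, hy, hz]
  | h_add x z hx hz => simp only [map_add, LinearMap.add_apply, hx, hz]

theorem weightMul_killingForm (f : (H → ℂ) → ℂ) (x y : 𝔤) :
    killingForm ℂ 𝔤 (weightMul H f x) y =
      killingForm ℂ 𝔤 x (weightMul H (fun χ => f (-χ)) y) := by
  have := killingForm_weightMul (H := H) (f := f) (g := fun _ => 1) (f' := fun _ => 1)
    (g' := fun χ => f (-χ)) (by simp) x y
  rwa [weightMul_one, weightMul_one] at this

theorem eq_of_killingForm_eq {x y : 𝔤} (h : ∀ z, killingForm ℂ 𝔤 x z = killingForm ℂ 𝔤 y z) :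
    x = y := by
  rw [← sub_eq_zero, ← Submodule.mem_bot ℂ, ← ker_killingForm_eq_bot ℂ 𝔤, LinearMap.mem_ker]
  ext z
  simp [h z]

/-- `weightMul` of the indicator function of a set of functionals. -/
def weightInd (A : Set (H → ℂ)) : Module.End ℂ 𝔤 :=
  weightMul H (A.indicator 1)

theorem weightInd_eq_self_iff {A : Set (H → ℂ)} {x : 𝔤} :
    weightInd A x = x ↔ x ∈ ⨆ χ ∈ A, (rootSpace H χ).toSubmodule := by
  constructor
  · intro h
    rw [← h]
    clear h
    induction x using rootSpace_induction (H := H) with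
    | h χ x hx =>
      rw [weightInd, weightMul_apply_of_mem _ hx]
      by_cases hχ : (χ : H → ℂ) ∈ A
      · exact Submodule.smul_mem _ _ (Submodule.mem_iSup_of_mem _ (Submodule.mem_iSup_of_mem hχ hx))
      · simp [hχ]
    | h_add x y hx hy => rw [map_add]; exact add_mem hx hy
  · intro h
    have : (⨆ χ ∈ A, (rootSpace H χ).toSubmodule) ≤
        LinearMap.ker (weightInd (H := H) (𝔤 := 𝔤) A - LinearMap.id) := by
      refine iSup₂_le fun χ hχ x hx => ?_
      simp [weightInd, weightMul_apply_of_mem _ (show x ∈ rootSpace H χ from hx), hχ]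
    simpa [sub_eq_zero] using this h

theorem weightInd_zero_mem (x : 𝔤) : weightInd (H := H) {0} x ∈ H := by
  induction x using rootSpace_induction (H := H) with
  | h χ x hx =>
    rw [weightInd, weightMul_apply_of_mem _ hx]
    by_cases hχ : (χ : H → ℂ) = 0
    · rw [hχ, rootSpace_zero_eq] at hx
      exact H.smul_mem _ hx
    · simp [hχ]
  | h_add x y hx hy => rw [map_add]; exact add_mem hx hy

theorem coe_mem_rootSpace_zero (h : H) : (h : 𝔤) ∈ rootSpace H (0 : H → ℂ) := by
  rw [rootSpace_zero_eq]
  exact h.2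

theorem weightMul_coe (f : (H → ℂ) → ℂ) (h : H) : weightMul H f (h : 𝔤) = f 0 • (h : 𝔤) :=
  weightMul_apply_of_mem _ (coe_mem_rootSpace_zero h)

theorem cartan_lie_eq_zero (h k : H) : ⁅(h : 𝔤), (k : 𝔤)⁆ = 0 := by
  have := lie_eq_smul_of_mem_rootSpace (coe_mem_rootSpace_zero k) h
  simpa using this

end WeightMultiplier

/-! ### Calculus on finite-dimensional topological vector spaces. -/

section Calculus

/-- Only a topology is given on `𝔤`; a norm inducing it gives access to normed-space calculus inside
proofs. -/
theorem exists_norm_core (E : Type*) [AddCommGroup E] [Module ℂ E] [FiniteDimensional ℂ E] :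
    ∃ _ : Norm E, NormedSpace.Core ℂ E := by
  let e := (Module.finBasis ℂ E).equivFun
  let n : Norm E := ⟨fun x => ‖e x‖⟩
  refine ⟨n, ⟨⟨fun x => norm_nonneg (e x), fun c x => ?_, fun x y => ?_⟩, fun x => ?_⟩⟩
  · change ‖e (c • x)‖ = ‖c‖ * ‖e x‖
    rw [map_smul, norm_smul]
  · change ‖e (x + y)‖ ≤ ‖e x‖ + ‖e y‖
    rw [map_add]
    exact norm_add_le _ _
  · change ‖e x‖ = 0 ↔ x = 0
    simp

/-- A norm on a finite-dimensional vector space. -/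
abbrev finNorm (E : Type*) [AddCommGroup E] [Module ℂ E] [FiniteDimensional ℂ E] : Norm E :=
  (exists_norm_core E).choose

theorem finNorm_core (E : Type*) [AddCommGroup E] [Module ℂ E] [FiniteDimensional ℂ E] :
    let := finNorm E
    NormedSpace.Core ℂ E :=
  (exists_norm_core E).choose_spec

section TVS

variable (E : Type*) [AddCommGroup E] [Module ℂ E] [FiniteDimensional ℂ E]
  [T : TopologicalSpace E] [IsTopologicalAddGroup E] [ContinuousSMul ℂ E] [T2Space E]

/-- The topology of a finite-dimensional Hausdorff topological vector space comes from a norm. -/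
abbrev finNormedAddCommGroup : NormedAddCommGroup E :=
  letI : Norm E := finNorm E
  NormedAddCommGroup.ofCoreReplaceTopology (finNorm_core E) (by
    have h1 := (isModuleTopologyOfFiniteDimensional (𝕜 := ℂ) (E := E)).eq_moduleTopology'
    let n : NormedAddCommGroup E := NormedAddCommGroup.ofCore (finNorm_core E)
    let s : NormedSpace ℂ E := NormedSpace.ofCore (finNorm_core E)
    have h2 := (@isModuleTopologyOfFiniteDimensional ℂ _ E _ _
      n.toPseudoMetricSpace.toUniformSpace.toTopologicalSpace _ _ _ _ _).eq_moduleTopology'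
    exact h1.trans h2.symm)

/-- The normed space structure that goes with `finNormedAddCommGroup`. -/
abbrev finNormedSpace : @NormedSpace ℂ E _ (finNormedAddCommGroup E).toSeminormedAddCommGroup :=
  let := finNormedAddCommGroup E
  NormedSpace.ofCore (finNorm_core E)

end TVS

section Derivative

variable {E : Type*} [AddCommGroup E] [Module ℂ E] [FiniteDimensional ℂ E]
  [TopologicalSpace E] [IsTopologicalAddGroup E] [ContinuousSMul ℂ E] [T2Space E]
  {F : Type*} [AddCommGroup F] [Module ℂ F] [FiniteDimensional ℂ F]
  [TopologicalSpace F] [IsTopologicalAddGroup F] [ContinuousSMul ℂ F] [T2Space F]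
  {G : Type*} [AddCommGroup G] [Module ℂ G] [FiniteDimensional ℂ G]
  [TopologicalSpace G] [IsTopologicalAddGroup G] [ContinuousSMul ℂ G] [T2Space G]


/-- A functional that vanishes on `W` kills `f` near `x`, hence kills its derivative; such
functionals separate `W` from the vectors outside it. -/
theorem mem_of_hasFDerivAt_of_eventually_mem {f : E → F} {f' : E →L[ℂ] F} {x : E}
    (hf : HasFDerivAt f f' x) {W : Submodule ℂ F}
    (hW : ∀ᶠ y in nhds x, f y ∈ W) (v : E) : f' v ∈ W := by
  let := finNormedAddCommGroup E
  let := finNormedAddCommGroup F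
  let := finNormedSpace E
  let := finNormedSpace F
  by_contra hv
  obtain ⟨g, hg, hgW⟩ := Submodule.exists_le_ker_of_notMem hv
  have h1 : HasFDerivAt (fun y => g.toContinuousLinearMap (f y))
      (g.toContinuousLinearMap ∘L f') x := g.toContinuousLinearMap.hasFDerivAt.comp x hf
  have h2 : HasFDerivAt (fun y => g.toContinuousLinearMap (f y)) (0 : E →L[ℂ] ℂ) x := by
    refine (hasFDerivAt_const (0 : ℂ) x).congr_of_eventuallyEq ?_
    filter_upwards [hW] with y hy
    exact hgW hy
  exact hg (by simpa using congrArg (fun A : E →L[ℂ] ℂ => A v) (h1.unique h2))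

theorem eq_of_hasFDerivAt_zero {U : Set E} (hUo : IsOpen U) (hUc : IsPreconnected U) {f : E → F}
    (hf : ∀ x ∈ U, HasFDerivAt f (0 : E →L[ℂ] F) x) {x y : E} (hx : x ∈ U) (hy : y ∈ U) :
    f x = f y := by
  let := finNormedAddCommGroup E
  let := finNormedAddCommGroup F
  let := finNormedSpace E
  let := finNormedSpace F
  let : NormedSpace ℝ E := NormedSpace.restrictScalars ℝ ℂ E
  exact hUo.is_const_of_fderiv_eq_zero (𝕜 := ℂ) hUc
    (fun z hz => (hf z hz).differentiableAt.differentiableWithinAt) (fun z hz => (hf z hz).fderiv)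
    hx hy

/-- A section of the span of a differentiable frame is differentiable at a point if its image under
a linear map that is injective on the span at this point is constant. -/
theorem differentiableAt_of_mem_span {r : ℕ} {e : Fin r → E → F} {w : E → F} {x : E}
    (he : ∀ i, DifferentiableAt ℂ (e i) x) (p : F →ₗ[ℂ] G) {q : G}
    (hli : LinearIndependent ℂ fun i => p (e i x))
    (hw : ∀ᶠ y in nhds x, w y ∈ Submodule.span ℂ (Set.range fun i => e i y))
    (hpw : ∀ᶠ y in nhds x, p (w y) = q) : DifferentiableAt ℂ w x := by
  let := finNormedAddCommGroup E
  let := finNormedAddCommGroup F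
  let := finNormedAddCommGroup G
  let := finNormedSpace E
  let := finNormedSpace F
  let := finNormedSpace G
  obtain ⟨T, hT⟩ := (Fintype.linearCombination ℂ fun i => p (e i x)).exists_leftInverse_of_injective
    (LinearMap.ker_eq_bot.mpr (hli.fintypeLinearCombination_injective))
  let B : F →L[ℂ] (Fin r → ℂ) := (T ∘ₗ p).toContinuousLinearMap
  -- `A y` sends coefficients `c` to `T (p (∑ cᵢ eᵢ(y)))`. It is the identity at `x`, hence
  -- invertible nearby, and the coefficients of `w y` solve `A y c = T q`; so they are
  -- differentiable in `y`.
  let A : E → ((Fin r → ℂ) →L[ℂ] (Fin r → ℂ)) := fun y =>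
    ∑ i, (ContinuousLinearMap.proj (R := ℂ) (φ := fun _ : Fin r => ℂ) i).smulRight (B (e i y))
  have hA : DifferentiableAt ℂ A x := by
    refine DifferentiableAt.fun_sum fun i _ => ?_
    exact (ContinuousLinearMap.smulRightL ℂ (Fin r → ℂ) (Fin r → ℂ)
      (ContinuousLinearMap.proj (R := ℂ) (φ := fun _ : Fin r => ℂ) i)).differentiableAt.comp x
      (B.differentiableAt.comp x (he i))
  have hA1 : A x = 1 := by
    ext c : 1
    have := congrArg (fun f : (Fin r → ℂ) →ₗ[ℂ] (Fin r → ℂ) => f c) hT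
    simpa [A, B, Fintype.linearCombination_apply] using this
  have hunit : ∀ᶠ y in nhds x, IsUnit (A y) :=
    hA.continuousAt.eventually (Units.isOpen.mem_nhds (by rw [hA1]; exact isUnit_one))
  have hinv : DifferentiableAt ℂ (fun y => Ring.inverse (A y)) x :=
    (differentiableAt_inverse (𝕜 := ℂ) (x := A x) (by rw [hA1]; exact isUnit_one)).comp x hA
  have key : ∀ᶠ y in nhds x, w y = ∑ i, (Ring.inverse (A y) (T q)) i • e i y := by
    filter_upwards [hw, hpw, hunit] with y h1 h2 h3
    obtain ⟨c, hc⟩ := (Submodule.mem_span_range_iff_exists_fun ℂ).mp h1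
    have h4 : A y c = T q := by
      simp only [A, B, ← h2, ← hc, map_sum, map_smul, sum_apply,
        ContinuousLinearMap.smulRight_apply, ContinuousLinearMap.proj_apply,
        LinearMap.coe_toContinuousLinearMap', LinearMap.comp_apply]
    have h5 : Ring.inverse (A y) (T q) = c := by
      rw [← h4, ← mul_apply_eq_comp, Ring.inverse_mul_cancel _ h3]
      rfl
    rw [h5, hc]
  refine DifferentiableAt.congr_of_eventuallyEq ?_ key
  refine DifferentiableAt.fun_sum fun i _ => DifferentiableAt.smul ?_ (he i)
  exact ((ContinuousLinearMap.proj (R := ℂ) (φ := fun _ : Fin r => ℂ) i).differentiableAt.comp x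
    (hinv.clm_apply (differentiableAt_const _)))

end Derivative

end Calculus

/-! ### The grading of `𝔤` determined by `S`. -/

section Grading

variable {𝔤 : Type*} [LieRing 𝔤] [LieAlgebra ℂ 𝔤] [FiniteDimensional ℂ 𝔤] [LieAlgebra.IsSimple ℂ 𝔤]
  {H : LieSubalgebra ℂ 𝔤} [H.IsCartanSubalgebra]

/-- The simple roots take arbitrary values at a suitable element of the Cartan subalgebra. -/
theorem exists_forall_simple_apply_eq (b : (rootSystem H).Base) (c : H.root → ℂ) :
    ∃ h : H, ∀ i ∈ b.support, (i : LieModule.Weight ℂ H 𝔤) h = c i := by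
  let f : Module.Dual ℂ (Module.Dual ℂ H) := b.toWeightBasis.constr ℂ fun i => c i
  refine ⟨(Module.evalEquiv ℂ H).symm f, fun i hi => ?_⟩
  have h1 : f (b.toWeightBasis ⟨i, hi⟩) = c i := by
    rw [Module.Basis.constr_basis]
  rw [b.toWeightBasis_apply] at h1
  rw [← h1]
  exact Module.apply_evalEquiv_symm_apply ℂ H ((rootSystem H).root i) f

/-- An element of the Cartan subalgebra that cuts out `[S]` among the positive roots. -/
structure IsGrading (b : (rootSystem H).Base) (S : Set H.root) (g : H) : Prop where
  re_nonneg : ∀ α : H.root, b.IsPos α → 0 ≤ ((α : LieModule.Weight ℂ H 𝔤) g).re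
  mem_iff : ∀ α : H.root, b.IsPos α →
    (α ∈ spannedRoots b S ↔ ((α : LieModule.Weight ℂ H 𝔤) g).re = 0)

theorem weight_apply_eq_add {i j k : H.root}
    (hk : (rootSystem H).root k = (rootSystem H).root i + (rootSystem H).root j) (h : H) :
    (k : LieModule.Weight ℂ H 𝔤) h =
      (i : LieModule.Weight ℂ H 𝔤) h + (j : LieModule.Weight ℂ H 𝔤) h :=
  congrArg (fun f : Module.Dual ℂ H => f h) hk

/-- Give the simple roots in `S` the value 0 and the others the value 1: `α g` is then the sum of
the coefficients of `α` outside `S`. Both directions follow by building positive roots from simple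
ones. -/
theorem exists_isGrading (b : (rootSystem H).Base) (S : Set H.root)
    (hS : S ⊆ (b.support : Set H.root)) : ∃ g : H, IsGrading b S g := by
  classical
  obtain ⟨g, hg⟩ := exists_forall_simple_apply_eq b (fun i => if i ∈ S then 0 else 1)
  have hpos : ∀ α : H.root, b.IsPos α → 0 ≤ ((α : LieModule.Weight ℂ H 𝔤) g).re := by
    intro α hα
    refine hα.induction_on_add (p := fun α : H.root => 0 ≤ ((α : LieModule.Weight ℂ H 𝔤) g).re)
      (fun i hi => ?_) (fun i j k hk h hj => ?_)
    · rw [hg i hi]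
      split_ifs <;> simp
    · rw [weight_apply_eq_add hk, hg j hj, Complex.add_re]
      split_ifs <;> simp <;> linarith
  refine ⟨g, hpos, fun α hα => ⟨fun h => ?_, fun h => ⟨hα, ?_⟩⟩⟩
  · have key : ∀ f ∈ AddSubmonoid.closure ((rootSystem H).root '' S), f g = 0 := by
      intro f hf
      induction hf using AddSubmonoid.closure_induction with
      | mem f hf =>
        obtain ⟨i, hi, rfl⟩ := hf
        have := hg i (hS hi)
        rw [if_pos hi] at this
        exact this
      | zero => simp
      | add f f' _ _ h h' => simp [h, h']
    have := key _ h.2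
    rw [rootSystem_root_apply, LieModule.Weight.toLinear_apply] at this
    rw [this, Complex.zero_re]
  · refine (hα.induction_on_add (p := fun α : H.root => b.IsPos α ∧
      (((α : LieModule.Weight ℂ H 𝔤) g).re = 0 →
        (rootSystem H).root α ∈ AddSubmonoid.closure ((rootSystem H).root '' S)))
      (fun i hi => ⟨RootPairing.Base.isPos_of_mem_support hi, fun h => ?_⟩)
      (fun i j k hk hi hj => ?_)).2 h
    · rw [hg i hi] at h
      split_ifs at h with hiS
      · exact AddSubmonoid.subset_closure ⟨i, hiS, rfl⟩
      · simp at h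
    · have hjp := RootPairing.Base.isPos_of_mem_support hj
      refine ⟨hi.1.add hjp hk, fun h => ?_⟩
      rw [weight_apply_eq_add hk, Complex.add_re] at h
      have h1 := hpos i hi.1
      have h2 := hpos j hjp
      rw [hk]
      refine add_mem (hi.2 (by linarith)) (AddSubmonoid.subset_closure ⟨j, ?_, rfl⟩)
      by_contra hjS
      rw [hg j hj, if_neg hjS, Complex.one_re] at h
      linarith

theorem exists_isPos_eq_or_eq_neg (b : (rootSystem H).Base) {χ : H → ℂ} (hχ : χ ≠ 0)
    (h : rootSpace H χ ≠ ⊥) :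
    ∃ α : H.root, b.IsPos α ∧
      (χ = (α : LieModule.Weight ℂ H 𝔤) ∨ χ = -⇑(α : LieModule.Weight ℂ H 𝔤)) := by
  let ψ : LieModule.Weight ℂ H 𝔤 := ⟨χ, h⟩
  have hψ : ψ ∈ H.root := by
    simp only [LieSubalgebra.root, Finset.mem_filter, Finset.mem_univ, true_and]
    exact hχ
  rcases RootPairing.Base.IsPos.or_neg b ⟨ψ, hψ⟩ with h1 | h1
  · exact ⟨_, h1, Or.inl rfl⟩
  · refine ⟨_, h1, Or.inr ?_⟩
    have h2 := (rootSystem H).root_reflectionPerm ⟨ψ, hψ⟩ ⟨ψ, hψ⟩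
    rw [RootPairing.reflection_apply_self] at h2
    ext h
    have h3 := congrArg (fun f : Module.Dual ℂ H => -f h) h2
    exact (neg_neg (χ h)).symm.trans h3.symm

variable {b : (rootSystem H).Base} {S : Set H.root} {g : H}

/-- With its two companions below, this trades the combinatorics of `[S]` for sign conditions on
degrees, which behave well under sums and negation. -/
theorem IsGrading.nPos_sup_nNeg_eq (hg : IsGrading b S g) :
    nPos b S ⊔ nNeg b S = ⨆ χ ∈ {χ : H → ℂ | χ ≠ 0 ∧ (χ g).re = 0}, (rootSpace H χ).toSubmodule := by
  apply le_antisymm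
  · refine sup_le (iSup₂_le fun α hα => ?_) (iSup₂_le fun α hα => ?_)
    · refine le_biSup (fun χ => (rootSpace H χ).toSubmodule)
        (i := ⇑(α : LieModule.Weight ℂ H 𝔤)) ⟨H.isNonZero_coe_root α, ?_⟩
      exact (hg.mem_iff α hα.1).mp hα
    · refine le_biSup (fun χ => (rootSpace H χ).toSubmodule)
        (i := -⇑(α : LieModule.Weight ℂ H 𝔤)) ⟨neg_ne_zero.mpr (H.isNonZero_coe_root α), ?_⟩
      simpa using (hg.mem_iff α hα.1).mp hα
  · refine iSup₂_le fun χ hχ => ?_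
    by_cases h : rootSpace H χ = ⊥
    · simp [h]
    · obtain ⟨α, hα, rfl | rfl⟩ := exists_isPos_eq_or_eq_neg b hχ.1 h
      · exact le_sup_of_le_left (le_biSup
          (fun α : H.root => (rootSpace H (α : LieModule.Weight ℂ H 𝔤)).toSubmodule)
          ((hg.mem_iff α hα).mpr hχ.2))
      · exact le_sup_of_le_right (le_biSup
          (fun α : H.root => (rootSpace H (-⇑(α : LieModule.Weight ℂ H 𝔤))).toSubmodule)
          ((hg.mem_iff α hα).mpr (by simpa using hχ.2)))

theorem IsGrading.kPos_eq (hg : IsGrading b S g) :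
    kPos b S = ⨆ χ ∈ {χ : H → ℂ | 0 < (χ g).re}, (rootSpace H χ).toSubmodule := by
  apply le_antisymm
  · refine iSup₂_le fun α hα => ?_
    refine le_biSup (fun χ => (rootSpace H χ).toSubmodule)
      (i := ⇑(α : LieModule.Weight ℂ H 𝔤)) ?_
    exact lt_of_le_of_ne (hg.re_nonneg α hα.1) (fun h => hα.2 ((hg.mem_iff α hα.1).mpr h.symm))
  · refine iSup₂_le fun χ (hχ : 0 < (χ g).re) => ?_
    by_cases h : rootSpace H χ = ⊥
    · simp [h]
    · obtain ⟨α, hα, rfl | rfl⟩ := exists_isPos_eq_or_eq_neg b (by rintro rfl; simp at hχ) h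
      · exact le_biSup
          (fun α : H.root => (rootSpace H (α : LieModule.Weight ℂ H 𝔤)).toSubmodule)
          (show α ∈ {α | b.IsPos α} \ spannedRoots b S from
            ⟨hα, fun h => hχ.ne' ((hg.mem_iff α hα).mp h)⟩)
      · have := hg.re_nonneg α hα
        simp only [Pi.neg_apply, Complex.neg_re] at hχ
        linarith

theorem IsGrading.kNeg_eq (hg : IsGrading b S g) :
    kNeg b S = ⨆ χ ∈ {χ : H → ℂ | (χ g).re < 0}, (rootSpace H χ).toSubmodule := by
  apply le_antisymm
  · refine iSup₂_le fun α hα => ?_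
    refine le_biSup (fun χ => (rootSpace H χ).toSubmodule)
      (i := -⇑(α : LieModule.Weight ℂ H 𝔤)) ?_
    have := lt_of_le_of_ne (hg.re_nonneg α hα.1)
      (fun h => hα.2 ((hg.mem_iff α hα.1).mpr h.symm))
    simpa using this
  · refine iSup₂_le fun χ (hχ : (χ g).re < 0) => ?_
    by_cases h : rootSpace H χ = ⊥
    · simp [h]
    · obtain ⟨α, hα, rfl | rfl⟩ := exists_isPos_eq_or_eq_neg b (by rintro rfl; simp at hχ) h
      · have := hg.re_nonneg α hα
        linarith
      · exact le_biSup
          (fun α : H.root => (rootSpace H (-⇑(α : LieModule.Weight ℂ H 𝔤))).toSubmodule)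
          (show α ∈ {α | b.IsPos α} \ spannedRoots b S from
            ⟨hα, fun h => by have := (hg.mem_iff α hα).mp h; simp [this] at hχ⟩)

end Grading

/-! ### Nonvanishing brackets of root spaces. -/

section RootStrings

variable {𝔤 : Type*} [LieRing 𝔤] [LieAlgebra ℂ 𝔤] [FiniteDimensional ℂ 𝔤] [LieAlgebra.IsSimple ℂ 𝔤]
  {H : LieSubalgebra ℂ 𝔤} [H.IsCartanSubalgebra]

/-- Let `x` be a top vector of the `α`-string through `β`, with `β` lying `n + 1` steps below it;
there is at least one step because `α + β` is a weight. In the `𝔰𝔩₂`-module generated by `x`, `e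
f^{n+1} x = (n+1)(ℓ - n) f^n x`, where `ℓ` is the length of the string and `n < ℓ`. -/
theorem exists_lie_ne_zero {α β γ : LieModule.Weight ℂ H 𝔤} (hα : α.IsNonZero)
    (hγ : (γ : H → ℂ) = α + β) :
    ∃ x ∈ rootSpace H α, ∃ y ∈ rootSpace H β, ⁅x, y⁆ ≠ 0 := by
  obtain ⟨x, hx, x_ne0⟩ := (LieModule.chainTop α β).exists_ne_zero
  obtain ⟨h, e, f, isSl2, he, hf⟩ := exists_isSl2Triple_of_weight_isNonZero hα
  obtain rfl := isSl2.h_eq_coroot hα he hf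
  have prim : isSl2.HasPrimitiveVectorWith x (chainLength α β : ℂ) :=
    have := lie_mem_genWeightSpace_of_mem_genWeightSpace he hx
    ⟨x_ne0, (chainLength_smul _ _ hx).symm, by
      rwa [LieModule.genWeightSpace_add_chainTop _ _ hα] at this⟩
  have h1 : (LieModule.chainTopCoeff α γ : ℤ) = LieModule.chainTopCoeff α β - 1 :=
    chainTopCoeff_of_eq_zsmul_add α β hα γ 1 (by simpa using hγ)
  obtain ⟨n, hn⟩ : ∃ n, LieModule.chainTopCoeff α β = n + 1 :=
    ⟨LieModule.chainTopCoeff α γ, by omega⟩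
  have hle := chainTopCoeff_le_chainLength α β
  have hmem := toEnd_pow_apply_mem hf hx (n + 1)
  rw [LieModule.coe_chainTop', hn] at hmem
  have hw : (n + 1) • -(α : H → ℂ) + ((n + 1) • (α : H → ℂ) + β) = β := by
    rw [smul_neg, neg_add_cancel_left]
  rw [hw] at hmem
  refine ⟨e, he, _, hmem, ?_⟩
  rw [prim.lie_e_pow_succ_toEnd_f n]
  refine smul_ne_zero (mul_ne_zero (by exact_mod_cast n.succ_ne_zero) ?_)
    (prim.pow_toEnd_f_ne_zero_of_eq_nat rfl (by omega))
  rw [sub_ne_zero]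
  exact_mod_cast (show chainLength α β ≠ n by omega)

theorem exists_smul_eq_of_mem_rootSpace {α : LieModule.Weight ℂ H 𝔤} (hα : α.IsNonZero) {x y : 𝔤}
    (hx : x ∈ rootSpace H α) (hx0 : x ≠ 0) (hy : y ∈ rootSpace H α) : ∃ c : ℂ, c • x = y := by
  obtain ⟨c, hc⟩ := (finrank_eq_one_iff_of_nonzero' (⟨x, hx⟩ : rootSpace H α)
    (by simpa using hx0)).mp (finrank_rootSpace_eq_one α hα) ⟨y, hy⟩
  exact ⟨c, by simpa using congrArg Subtype.val hc⟩

end RootStrings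

/-! ### Projections, the Cartan part, and the torus `Ad e^h`. -/

section Indicator

variable {𝔤 : Type*} [LieRing 𝔤] [LieAlgebra ℂ 𝔤] [FiniteDimensional ℂ 𝔤] [LieAlgebra.IsSimple ℂ 𝔤]
  {H : LieSubalgebra ℂ 𝔤} [H.IsCartanSubalgebra]

theorem weightInd_weightInd (A B : Set (H → ℂ)) (x : 𝔤) :
    weightInd A (weightInd B x) = weightInd (A ∩ B) x := by
  rw [weightInd, weightInd, weightMul_mul_apply, weightInd]
  congr 2
  ext χ
  rw [Set.inter_indicator_one]
  rfl

theorem weightInd_union {A B : Set (H → ℂ)} (h : Disjoint A B) (x : 𝔤) :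
    weightInd (A ∪ B) x = weightInd A x + weightInd B x := by
  rw [weightInd, weightInd, weightInd, ← weightMul_add_apply]
  congr 2
  exact Set.indicator_union_of_disjoint h _

theorem weightInd_empty (x : 𝔤) : weightInd (∅ : Set (H → ℂ)) x = 0 := by
  rw [weightInd, Set.indicator_empty]
  exact weightMul_zero x

theorem weightInd_eq_self_of_subset {A B : Set (H → ℂ)} {x : 𝔤} (hx : weightInd A x = x)
    (h : A ⊆ B) : weightInd B x = x := by
  rw [← hx, weightInd_weightInd, Set.inter_eq_right.mpr h]

theorem weightInd_eq_zero_of_disjoint {A B : Set (H → ℂ)} {x : 𝔤} (hx : weightInd A x = x)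
    (h : Disjoint A B) : weightInd B x = 0 := by
  rw [← hx, weightInd_weightInd, h.symm.inter_eq, weightInd_empty]

theorem weightInd_coe_of_mem {A : Set (H → ℂ)} (h : 0 ∈ A) (k : H) :
    weightInd A (k : 𝔤) = k := by
  rw [weightInd, weightMul_coe]
  simp [h]

theorem weightInd_coe_of_notMem {A : Set (H → ℂ)} (h : 0 ∉ A) (k : H) :
    weightInd A (k : 𝔤) = 0 := by
  rw [weightInd, weightMul_coe]
  simp [h]

theorem weightMul_weightInd_comm (f : (H → ℂ) → ℂ) (A : Set (H → ℂ)) (x : 𝔤) :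
    weightMul H f (weightInd A x) = weightInd A (weightMul H f x) := by
  rw [weightInd, weightMul_mul_apply, weightMul_mul_apply]
  congr 2
  ext χ
  exact mul_comm _ _

theorem killingForm_weightInd {A B : Set (H → ℂ)} (h : ∀ χ, χ ∈ A ↔ -χ ∈ B) (x y : 𝔤) :
    killingForm ℂ 𝔤 (weightInd A x) y = killingForm ℂ 𝔤 x (weightInd B y) := by
  rw [weightInd, weightMul_killingForm, weightInd]
  congr 3
  ext χ
  by_cases hχ : χ ∈ B
  · have : -χ ∈ A := by rw [h, neg_neg]; exact hχ
    simp [hχ, this]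
  · have : -χ ∉ A := by rw [h, neg_neg]; exact hχ
    simp [hχ, this]

theorem killingForm_coe_left (h : H) (x : 𝔤) :
    killingForm ℂ 𝔤 (h : 𝔤) x = killingForm ℂ 𝔤 (h : 𝔤) (weightInd (H := H) {0} x) := by
  rw [← killingForm_weightInd (A := {0}) (by simp), weightInd_coe_of_mem (Set.mem_singleton 0)]

theorem killingForm_comm (x y : 𝔤) : killingForm ℂ 𝔤 x y = killingForm ℂ 𝔤 y x :=
  LieModule.traceForm_comm ℂ 𝔤 𝔤 x y

theorem killingForm_lie (x y z : 𝔤) : killingForm ℂ 𝔤 ⁅x, y⁆ z = killingForm ℂ 𝔤 x ⁅y, z⁆ :=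
  LieModule.traceForm_apply_lie_apply ℂ 𝔤 𝔤 x y z

variable (H) in
/-- The projection of `𝔤` onto the Cartan subalgebra along the root spaces of the roots. -/
def cartanPart : 𝔤 →ₗ[ℂ] H :=
  LinearMap.codRestrict H.toSubmodule (weightInd (H := H) {0}) weightInd_zero_mem

theorem coe_cartanPart (x : 𝔤) : (cartanPart H x : 𝔤) = weightInd (H := H) {0} x := rfl

/-- Root spaces of nonzero roots are orthogonal to the Cartan subalgebra, so only the Cartan part of
`x` matters. -/
theorem cartanEquivDual_symm_eq {f : Module.Dual ℂ H} {x : 𝔤}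
    (h : ∀ v : H, f v = killingForm ℂ 𝔤 x v) : (cartanEquivDual H).symm f = cartanPart H x := by
  rw [LinearEquiv.symm_apply_eq]
  ext v
  rw [h, cartanEquivDual_apply_apply, killingForm_comm, killingForm_coe_left, killingForm_comm]
  rfl

/-- `Ad (exp h)` for `h` in the Cartan subalgebra. -/
def torus (h : H) : Module.End ℂ 𝔤 :=
  weightMul H fun χ => Complex.exp (χ h)

theorem torus_apply_of_mem (h : H) {χ : H → ℂ} {x : 𝔤} (hx : x ∈ rootSpace H χ) :
    torus h x = Complex.exp (χ h) • x :=
  weightMul_apply_of_mem _ hx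

theorem torus_coe (h k : H) : torus h (k : 𝔤) = k := by
  rw [torus, weightMul_coe]
  simp

theorem torus_torus_of_forall_weight {h k l : H} (hl : l = h + k) (x : 𝔤) :
    torus h (torus k x) = torus l x := by
  induction x using rootSpace_induction (H := H) with
  | h χ x hx =>
    -- Additivity of `χ` is available only when `χ` is a weight; otherwise `x = 0`.
    by_cases h0 : rootSpace H χ = ⊥
    · rw [h0, LieSubmodule.mem_bot] at hx
      simp [hx]
    · let ψ : LieModule.Weight ℂ H 𝔤 := ⟨χ, h0⟩
      have : χ l = χ h + χ k := by
        rw [hl]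
        exact map_add ψ.toLinear h k
      rw [torus_apply_of_mem _ hx, map_smul, torus_apply_of_mem _ hx, torus_apply_of_mem _ hx,
        smul_smul, this, Complex.exp_add, mul_comm]
  | h_add x y hx hy => simp [hx, hy]

theorem torus_torus (h k : H) (x : 𝔤) : torus h (torus k x) = torus (h + k) x :=
  torus_torus_of_forall_weight rfl x

theorem torus_zero (x : 𝔤) : torus (0 : H) x = x := by
  induction x using rootSpace_induction (H := H) with
  | h χ x hx =>
    by_cases h0 : rootSpace H χ = ⊥
    · rw [h0, LieSubmodule.mem_bot] at hx
      simp [hx]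
    · let ψ : LieModule.Weight ℂ H 𝔤 := ⟨χ, h0⟩
      have : χ 0 = 0 := map_zero ψ.toLinear
      rw [torus_apply_of_mem _ hx, this, Complex.exp_zero, one_smul]
  | h_add x y hx hy => simp [hx, hy]

theorem torus_neg_torus (h : H) (x : 𝔤) : torus (-h) (torus h x) = x := by
  rw [torus_torus, neg_add_cancel, torus_zero]

theorem torus_torus_neg (h : H) (x : 𝔤) : torus h (torus (-h) x) = x := by
  rw [torus_torus, add_neg_cancel, torus_zero]

theorem torus_lie (h : H) (x y : 𝔤) : torus h ⁅x, y⁆ = ⁅torus h x, torus h y⁆ := by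
  have := weightMul_lie (H := H) (k := fun χ => Complex.exp (χ h)) (f := fun _ => 1)
    (g := fun _ => 1) (f' := fun χ => Complex.exp (χ h)) (g' := fun χ => Complex.exp (χ h))
    (by simp [Complex.exp_add]) x y
  rwa [weightMul_one, weightMul_one] at this

theorem killingForm_torus (h : H) (x y : 𝔤) :
    killingForm ℂ 𝔤 (torus h x) (torus h y) = killingForm ℂ 𝔤 x y := by
  have := killingForm_weightMul (H := H) (f := fun χ => Complex.exp (χ h))
    (g := fun χ => Complex.exp (χ h)) (f' := fun _ => 1) (g' := fun _ => 1)
    (by simp [← Complex.exp_add]) x y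
  rwa [weightMul_one, weightMul_one] at this

theorem torus_weightInd (h : H) (A : Set (H → ℂ)) (x : 𝔤) :
    torus h (weightInd A x) = weightInd A (torus h x) :=
  weightMul_weightInd_comm _ A x

theorem cartanPart_torus (h : H) (x : 𝔤) : cartanPart H (torus h x) = cartanPart H x := by
  apply Subtype.ext
  rw [coe_cartanPart, coe_cartanPart, ← torus_weightInd, ← coe_cartanPart, torus_coe]

theorem cartanPart_lie_coe (h : H) (x : 𝔤) : cartanPart H ⁅(h : 𝔤), x⁆ = 0 := by
  apply Subtype.ext
  rw [coe_cartanPart, ← weightMul_eval, ← weightMul_weightInd_comm, weightMul_eval,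
    ← coe_cartanPart, cartan_lie_eq_zero]
  rfl

/-- On a root space `ad h` is the scalar `χ h`, which leaves the scalar exponential series. This
links `torus` to the series in the theorem. -/
theorem hasSum_torus [TopologicalSpace 𝔤] [IsTopologicalAddGroup 𝔤] [ContinuousSMul ℂ 𝔤]
    (h : H) (x : 𝔤) :
    HasSum (fun n : ℕ => ((n.factorial : ℂ)⁻¹) • (LieAlgebra.ad ℂ 𝔤 (h : 𝔤) ^ n) x) (torus h x) := by
  induction x using rootSpace_induction (H := H) with
  | h χ x hx =>
    have h1 : ∀ n : ℕ, (LieAlgebra.ad ℂ 𝔤 (h : 𝔤) ^ n) x = χ h ^ n • x := by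
      intro n
      induction n with
      | zero => simp
      | succ n ih =>
        rw [pow_succ', Module.End.mul_apply, ih, map_smul, LieAlgebra.ad_apply,
          ← LieSubalgebra.coe_bracket_of_module, lie_eq_smul_of_mem_rootSpace hx, smul_smul, pow_succ]
    simp only [h1, smul_smul, torus_apply_of_mem h hx]
    have h2 : HasSum (fun n : ℕ => ((n.factorial : ℂ)⁻¹) * χ h ^ n) (Complex.exp (χ h)) := by
      rw [Complex.exp_eq_exp_ℂ]
      simpa using NormedSpace.exp_series_hasSum_exp' (𝕂 := ℂ) (χ h)
    exact h2.smul_const x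
  | h_add x y hx hy =>
    simp only [map_add, smul_add]
    exact hx.add hy

end Indicator

/-! ### The constant model: isotropy, maximality, bracket. -/

section Model

variable {𝔤 : Type*} [LieRing 𝔤] [LieAlgebra ℂ 𝔤] [FiniteDimensional ℂ 𝔤] [LieAlgebra.IsSimple ℂ 𝔤]
  {H : LieSubalgebra ℂ 𝔤} [H.IsCartanSubalgebra]

theorem pairing_apply (u v : Fiber H) : pairing H u v =
    (1 / 2 : ℂ) * (killingForm ℂ 𝔤 u.1 v.2.1 + killingForm ℂ 𝔤 u.2.1 v.1) +
      (1 / 4 : ℂ) * (killingForm ℂ 𝔤 u.2.2.2 v.2.2.2 - killingForm ℂ 𝔤 u.2.2.1 v.2.2.1) := rfl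

/-- The Levi part of the grading by `g`. -/
def leviSet (g : H) : Set (H → ℂ) := {χ | (χ g).re = 0}
/-- The functionals of `leviSet g` other than `0`. -/
def leviRootSet (g : H) : Set (H → ℂ) := {χ | χ ≠ 0 ∧ (χ g).re = 0}
/-- The functionals of positive degree. -/
def posSet (g : H) : Set (H → ℂ) := {χ | 0 < (χ g).re}
/-- The functionals of negative degree. -/
def negSet (g : H) : Set (H → ℂ) := {χ | (χ g).re < 0}
/-- The functionals of degree at least `0`. -/
def nonnegSet (g : H) : Set (H → ℂ) := {χ | 0 ≤ (χ g).re}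
/-- The functionals of degree at most `0`. -/
def nonposSet (g : H) : Set (H → ℂ) := {χ | (χ g).re ≤ 0}

theorem mem_leviSet {g : H} {χ : H → ℂ} : χ ∈ leviSet g ↔ (χ g).re = 0 := Iff.rfl

theorem mem_leviRootSet {g : H} {χ : H → ℂ} : χ ∈ leviRootSet g ↔ χ ≠ 0 ∧ (χ g).re = 0 := Iff.rfl

theorem mem_posSet {g : H} {χ : H → ℂ} : χ ∈ posSet g ↔ 0 < (χ g).re := Iff.rfl

theorem mem_negSet {g : H} {χ : H → ℂ} : χ ∈ negSet g ↔ (χ g).re < 0 := Iff.rfl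

theorem mem_nonnegSet {g : H} {χ : H → ℂ} : χ ∈ nonnegSet g ↔ 0 ≤ (χ g).re := Iff.rfl

theorem mem_nonposSet {g : H} {χ : H → ℂ} : χ ∈ nonposSet g ↔ (χ g).re ≤ 0 := Iff.rfl

theorem zero_mem_leviSet (g : H) : (0 : H → ℂ) ∈ leviSet g := by simp [mem_leviSet]

theorem weightInd_leviSet (g : H) (x : 𝔤) :
    weightInd (leviSet g) x = weightInd (H := H) {0} x + weightInd (leviRootSet g) x := by
  rw [← weightInd_union (Set.disjoint_singleton_left.mpr fun h => h.1 rfl)]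
  congr 2
  ext χ
  simp only [mem_leviSet, mem_leviRootSet, Set.mem_union, Set.mem_singleton_iff]
  by_cases h : χ = 0 <;> simp [h]

theorem weightInd_nonposSet (g : H) (x : 𝔤) :
    weightInd (nonposSet g) x = weightInd (leviSet g) x + weightInd (negSet g) x := by
  rw [← weightInd_union]
  · congr 2
    ext χ
    simp only [mem_leviSet, mem_nonposSet, mem_negSet, Set.mem_union, le_iff_lt_or_eq, or_comm]
  · exact Set.disjoint_left.mpr fun χ (h : _ = _) (h' : _ < _) => h'.ne h

theorem weightInd_nonnegSet (g : H) (x : 𝔤) :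
    weightInd (nonnegSet g) x = weightInd (leviSet g) x + weightInd (posSet g) x := by
  rw [← weightInd_union]
  · congr 2
    ext χ
    simp only [mem_leviSet, mem_nonnegSet, mem_posSet, Set.mem_union, le_iff_lt_or_eq,
      or_comm, eq_comm]
  · exact Set.disjoint_left.mpr fun χ (h : _ = _) (h' : _ < _) => h'.ne' h

theorem weightInd_add_compl (A : Set (H → ℂ)) (x : 𝔤) : weightInd A x + weightInd Aᶜ x = x := by
  rw [← weightInd_union disjoint_compl_right, Set.union_compl_self, weightInd, Set.indicator_univ]
  exact weightMul_one x

/-- Degrees add under the bracket, and two nonpositive degrees sum to 0 only if both are 0. -/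
theorem weightInd_leviSet_lie_of_nonpos (g : H) {x y : 𝔤} (hx : weightInd (nonposSet g) x = x)
    (hy : weightInd (nonposSet g) y = y) :
    weightInd (leviSet g) ⁅x, y⁆ = ⁅weightInd (leviSet g) x, weightInd (leviSet g) y⁆ := by
  have := weightMul_lie (H := H) (𝔤 := 𝔤) (k := (leviSet g).indicator 1)
    (f := (nonposSet g).indicator 1) (g := (nonposSet g).indicator 1)
    (f' := (leviSet g).indicator 1) (g' := (leviSet g).indicator 1) (fun χ ψ => ?_) x y
  · rw [weightInd] at hx hy
    rwa [hx, hy] at this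
  · classical
    simp only [Set.indicator_apply, mem_leviSet, mem_nonposSet, Pi.add_apply,
      Complex.add_re, Pi.one_apply]
    split_ifs <;> simp <;> grind

theorem weightInd_leviSet_lie_of_nonneg (g : H) {x y : 𝔤} (hx : weightInd (nonnegSet g) x = x)
    (hy : weightInd (nonnegSet g) y = y) :
    weightInd (leviSet g) ⁅x, y⁆ = ⁅weightInd (leviSet g) x, weightInd (leviSet g) y⁆ := by
  have := weightMul_lie (H := H) (𝔤 := 𝔤) (k := (leviSet g).indicator 1)
    (f := (nonnegSet g).indicator 1) (g := (nonnegSet g).indicator 1)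
    (f' := (leviSet g).indicator 1) (g' := (leviSet g).indicator 1) (fun χ ψ => ?_) x y
  · rw [weightInd] at hx hy
    rwa [hx, hy] at this
  · classical
    simp only [Set.indicator_apply, mem_leviSet, mem_nonnegSet, Pi.add_apply,
      Complex.add_re, Pi.one_apply]
    split_ifs <;> simp <;> grind

theorem weightInd_lie_eq_self {A : Set (H → ℂ)} (hA : ∀ χ ∈ A, ∀ ψ ∈ A, χ + ψ ∈ A) {x y : 𝔤}
    (hx : weightInd A x = x) (hy : weightInd A y = y) : weightInd A ⁅x, y⁆ = ⁅x, y⁆ := by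
  have := weightMul_lie (H := H) (𝔤 := 𝔤) (k := A.indicator 1)
    (f := A.indicator 1) (g := A.indicator 1)
    (f' := A.indicator 1) (g' := A.indicator 1) (fun χ ψ => ?_) x y
  · rw [weightInd] at hx hy
    rwa [hx, hy] at this
  · classical
    simp only [Set.indicator_apply, Pi.one_apply]
    split_ifs <;> grind

/-- Only opposite weights pair nontrivially, and two nonpositive degrees are opposite only if both
are 0. -/
theorem killingForm_eq_leviSet_of_nonpos (g : H) {x y : 𝔤} (hx : weightInd (nonposSet g) x = x)
    (hy : weightInd (nonposSet g) y = y) :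
    killingForm ℂ 𝔤 x y =
      killingForm ℂ 𝔤 (weightInd (leviSet g) x) (weightInd (leviSet g) y) := by
  have := killingForm_weightMul (H := H) (𝔤 := 𝔤)
    (f := (nonposSet g).indicator 1) (g := (nonposSet g).indicator 1)
    (f' := (leviSet g).indicator 1) (g' := (leviSet g).indicator 1) (fun χ => ?_) x y
  · rw [weightInd] at hx hy
    rwa [hx, hy] at this
  · classical
    simp only [Set.indicator_apply, mem_leviSet, mem_nonposSet, Pi.neg_apply,
      Complex.neg_re, Pi.one_apply]
    split_ifs <;> simp <;> grind

theorem killingForm_eq_leviSet_of_nonneg (g : H) {x y : 𝔤} (hx : weightInd (nonnegSet g) x = x)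
    (hy : weightInd (nonnegSet g) y = y) :
    killingForm ℂ 𝔤 x y =
      killingForm ℂ 𝔤 (weightInd (leviSet g) x) (weightInd (leviSet g) y) := by
  have := killingForm_weightMul (H := H) (𝔤 := 𝔤)
    (f := (nonnegSet g).indicator 1) (g := (nonnegSet g).indicator 1)
    (f' := (leviSet g).indicator 1) (g' := (leviSet g).indicator 1) (fun χ => ?_) x y
  · rw [weightInd] at hx hy
    rwa [hx, hy] at this
  · classical
    simp only [Set.indicator_apply, mem_leviSet, mem_nonnegSet, Pi.neg_apply,
      Complex.neg_re, Pi.one_apply]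
    split_ifs <;> simp <;> grind

/-- The fibre of the Dirac structure for `φ = id`. -/
def modelSpace (g : H) : Submodule ℂ (Fiber H) where
  carrier := {u |
    weightInd (leviSet g) u.2.2.1 = weightInd (leviSet g) (u.2.2.2 + (2 : ℂ) • (u.1 : 𝔤)) ∧
    weightInd (nonposSet g) u.2.2.1 = u.2.2.1 ∧
    weightInd (nonnegSet g) (u.2.2.2 + (2 : ℂ) • (u.1 : 𝔤)) = u.2.2.2 + (2 : ℂ) • (u.1 : 𝔤) ∧
    cartanPart H u.2.2.1 = u.2.1 + u.1}
  add_mem' := by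
    rintro u v ⟨h1, h2, h3, h4⟩ ⟨k1, k2, k3, k4⟩
    have e : (u + v).2.2.2 + (2 : ℂ) • ((u + v).1 : 𝔤) =
        (u.2.2.2 + (2 : ℂ) • (u.1 : 𝔤)) + (v.2.2.2 + (2 : ℂ) • (v.1 : 𝔤)) := by
      simp only [Prod.snd_add, Prod.fst_add, AddMemClass.coe_add, smul_add]
      abel
    refine ⟨?_, ?_, ?_, ?_⟩
    · rw [e, map_add, ← h1, ← k1, ← map_add]; rfl
    · change weightInd (nonposSet g) (u.2.2.1 + v.2.2.1) = _
      rw [map_add, h2, k2]; rfl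
    · rw [e, map_add, h3, k3]
    · change cartanPart H (u.2.2.1 + v.2.2.1) = (u.2.1 + v.2.1) + (u.1 + v.1)
      rw [map_add, h4, k4]
      abel
  zero_mem' := by simp
  smul_mem' := by
    rintro c u ⟨h1, h2, h3, h4⟩
    have e : (c • u).2.2.2 + (2 : ℂ) • ((c • u).1 : 𝔤) =
        c • (u.2.2.2 + (2 : ℂ) • (u.1 : 𝔤)) := by
      simp only [Prod.smul_snd, Prod.smul_fst, SetLike.val_smul, smul_add]
      rw [smul_comm]
    refine ⟨?_, ?_, ?_, ?_⟩
    · rw [e, map_smul, ← h1, ← map_smul]; rfl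
    · change weightInd (nonposSet g) (c • u.2.2.1) = _
      rw [map_smul, h2]; rfl
    · rw [e, map_smul, h3]
    · change cartanPart H (c • u.2.2.1) = c • u.2.1 + c • u.1
      rw [map_smul, h4, smul_add]

/-- The shift by `2ξ` is made for the vectors `(k, h, h + k, h - k)` of `d`: it turns `h - k` into
`h + k`, so that `X` and `Y + 2ξ` have the same Levi part throughout. -/
theorem mem_modelSpace {g : H} {u : Fiber H} : u ∈ modelSpace g ↔
    weightInd (leviSet g) u.2.2.1 = weightInd (leviSet g) (u.2.2.2 + (2 : ℂ) • (u.1 : 𝔤)) ∧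
    weightInd (nonposSet g) u.2.2.1 = u.2.2.1 ∧
    weightInd (nonnegSet g) (u.2.2.2 + (2 : ℂ) • (u.1 : 𝔤)) = u.2.2.2 + (2 : ℂ) • (u.1 : 𝔤) ∧
    cartanPart H u.2.2.1 = u.2.1 + u.1 := Iff.rfl

theorem cartanPart_weightInd {A : Set (H → ℂ)} (h : 0 ∈ A) (x : 𝔤) :
    cartanPart H (weightInd A x) = cartanPart H x := by
  apply Subtype.ext
  rw [coe_cartanPart, coe_cartanPart, weightInd_weightInd,
    Set.inter_eq_left.mpr (Set.singleton_subset_iff.mpr h)]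

theorem cartanPart_coe (h : H) : cartanPart H (h : 𝔤) = h :=
  Subtype.ext (weightInd_coe_of_mem (Set.mem_singleton 0) h)

theorem cartanPart_eq_of_mem_modelSpace {g : H} {u : Fiber H} (hu : u ∈ modelSpace g) :
    cartanPart H (u.2.2.2 + (2 : ℂ) • (u.1 : 𝔤)) = u.2.1 + u.1 := by
  obtain ⟨h1, -, -, h4⟩ := mem_modelSpace.mp hu
  rw [← h4, ← cartanPart_weightInd (zero_mem_leviSet g), ← h1,
    cartanPart_weightInd (zero_mem_leviSet g)]

/-- The Killing forms of the `X`'s and of the shifted `Y`'s agree, both being computed on the common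
Levi parts. The cross terms left by the shift involve only Cartan parts, and cancel the pairing of
tangent and cotangent vectors. -/
theorem modelSpace_isIsotropic (g : H) : IsIsotropic (modelSpace g) := by
  intro u hu v hv
  have cu := cartanPart_eq_of_mem_modelSpace hu
  have cv := cartanPart_eq_of_mem_modelSpace hv
  obtain ⟨h1, h2, h3, -⟩ := mem_modelSpace.mp hu
  obtain ⟨k1, k2, k3, -⟩ := mem_modelSpace.mp hv
  have e1 : killingForm ℂ 𝔤 u.2.2.1 v.2.2.1 =
      killingForm ℂ 𝔤 (u.2.2.2 + (2 : ℂ) • (u.1 : 𝔤)) (v.2.2.2 + (2 : ℂ) • (v.1 : 𝔤)) := by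
    rw [killingForm_eq_leviSet_of_nonpos g h2 k2, killingForm_eq_leviSet_of_nonneg g h3 k3, h1, k1]
  have e2 : killingForm ℂ 𝔤 (u.1 : 𝔤) (v.2.2.2 + (2 : ℂ) • (v.1 : 𝔤)) =
      killingForm ℂ 𝔤 (u.1 : 𝔤) ((v.2.1 : 𝔤) + v.1) := by
    rw [killingForm_coe_left, ← coe_cartanPart, cv]
    rfl
  have e3 : killingForm ℂ 𝔤 (v.1 : 𝔤) (u.2.2.2 + (2 : ℂ) • (u.1 : 𝔤)) =
      killingForm ℂ 𝔤 (v.1 : 𝔤) ((u.2.1 : 𝔤) + u.1) := by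
    rw [killingForm_coe_left, ← coe_cartanPart, cu]
    rfl
  rw [pairing_apply, e1]
  simp only [map_add, map_smul, LinearMap.add_apply, LinearMap.smul_apply, smul_eq_mul] at e2 e3 ⊢
  rw [killingForm_comm (u.2.2.2) (v.1 : 𝔤), killingForm_comm (u.2.1 : 𝔤) (v.1 : 𝔤)]
  rw [killingForm_comm (v.1 : 𝔤) (u.1 : 𝔤)] at e3
  linear_combination (-1 / 2) * e2 - (1 / 2) * e3

/-- Pairing with the diagonal of the Levi root spaces, with the negative and positive parts, and
with `d` recovers each defining condition, by nondegeneracy of the Killing form. -/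
theorem mem_modelSpace_of_forall_pairing_eq_zero (g : H) {u : Fiber H}
    (h : ∀ v ∈ modelSpace g, pairing H u v = 0) : u ∈ modelSpace g := by
  obtain ⟨ξ, η, X, Y⟩ := u
  have inter : ∀ (A B : Set (H → ℂ)), Disjoint A B → ∀ x : 𝔤, weightInd A (weightInd B x) = 0 :=
    fun A B hAB x => by rw [weightInd_weightInd, hAB.inter_eq, weightInd_empty]
  have sub : ∀ (A B : Set (H → ℂ)), B ⊆ A → ∀ x : 𝔤, weightInd A (weightInd B x) = weightInd B x :=
    fun A B hAB x => by rw [weightInd_weightInd, Set.inter_eq_right.mpr hAB]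
  have cartan0 : ∀ B : Set (H → ℂ), 0 ∉ B → ∀ x : 𝔤, cartanPart H (weightInd B x) = 0 :=
    fun B hB x => Subtype.ext (inter _ _ (Set.disjoint_singleton_left.mpr hB) x)
  have hlevi : ∀ x : 𝔤, killingForm ℂ 𝔤 Y (weightInd (leviRootSet g) x) =
      killingForm ℂ 𝔤 X (weightInd (leviRootSet g) x) := by
    intro x
    have := h (0, 0, weightInd (leviRootSet g) x, weightInd (leviRootSet g) x) (by
      rw [mem_modelSpace]
      simp only [ZeroMemClass.coe_zero, smul_zero, add_zero, true_and]
      refine ⟨sub _ _ (fun χ hχ => ?_) x, sub _ _ (fun χ hχ => ?_) x, cartan0 _ (fun h => h.1 rfl) x⟩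
      · exact hχ.2.le
      · exact hχ.2.ge)
    rw [pairing_apply] at this
    simp only [ZeroMemClass.coe_zero, map_zero, add_zero, mul_zero, zero_add] at this
    linear_combination 4 * this
  have hneg : ∀ x : 𝔤, killingForm ℂ 𝔤 X (weightInd (negSet g) x) = 0 := by
    intro x
    have := h (0, 0, weightInd (negSet g) x, 0) (by
      rw [mem_modelSpace]
      simp only [ZeroMemClass.coe_zero, smul_zero, add_zero, map_zero, true_and]
      refine ⟨inter _ _ (Set.disjoint_left.mpr fun χ (h1 : _ = _) (h2 : _ < _) => h2.ne h1) x,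
        sub _ _ (fun χ hχ => ?_) x, cartan0 _ (fun h => ?_) x⟩
      · exact (mem_negSet.mp hχ).le
      · rw [mem_negSet] at h
        simp at h)
    rw [pairing_apply] at this
    simp only [ZeroMemClass.coe_zero, map_zero, add_zero, mul_zero, zero_add] at this
    linear_combination -4 * this
  have hpos : ∀ x : 𝔤, killingForm ℂ 𝔤 Y (weightInd (posSet g) x) = 0 := by
    intro x
    have := h (0, 0, 0, weightInd (posSet g) x) (by
      rw [mem_modelSpace]
      simp only [ZeroMemClass.coe_zero, smul_zero, add_zero, map_zero, true_and]
      refine ⟨(inter _ _ (Set.disjoint_left.mpr fun χ (h1 : _ = _) (h2 : _ < _) => h2.ne' h1) x).symm,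
        sub _ _ (fun χ hχ => ?_) x, trivial⟩
      exact (mem_posSet.mp hχ).le)
    rw [pairing_apply] at this
    simp only [ZeroMemClass.coe_zero, map_zero, add_zero, mul_zero, zero_add] at this
    linear_combination 4 * this
  -- Below, `h' = 0` shows that `X + Y` has Cartan part `2η`, and `k = 0` that `X - Y` has Cartan
  -- part `2ξ`.
  have hcartan : ∀ h' k : H, 2 * (killingForm ℂ 𝔤 (ξ : 𝔤) h' + killingForm ℂ 𝔤 (η : 𝔤) k) +
      (killingForm ℂ 𝔤 Y ((h' : 𝔤) - k) - killingForm ℂ 𝔤 X ((h' : 𝔤) + k)) = 0 := by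
    intro h' k
    have := h (k, h', (h' : 𝔤) + k, (h' : 𝔤) - k) (by
      rw [mem_modelSpace]
      have e : (h' : 𝔤) - k + (2 : ℂ) • (k : 𝔤) = h' + k := by
        rw [two_smul]
        abel
      simp only [e, true_and, map_add, cartanPart_coe, and_true]
      refine ⟨?_, ?_⟩ <;>
      rw [weightInd_coe_of_mem (by simp [mem_nonposSet, mem_nonnegSet]),
        weightInd_coe_of_mem (by simp [mem_nonposSet, mem_nonnegSet])])
    rw [pairing_apply] at this
    simp only at this
    linear_combination 4 * this
  have ind_eq_zero : ∀ (A B : Set (H → ℂ)) (_ : ∀ χ, χ ∈ A ↔ -χ ∈ B) (x : 𝔤),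
      (∀ z, killingForm ℂ 𝔤 x (weightInd B z) = 0) → weightInd A x = 0 := by
    intro A B hAB x hx
    refine eq_of_killingForm_eq fun z => ?_
    rw [killingForm_weightInd hAB, hx, map_zero, LinearMap.zero_apply]
  have hX : weightInd (posSet g) X = 0 :=
    ind_eq_zero _ (negSet g) (fun χ => by simp [mem_posSet, mem_negSet]) X hneg
  have hY : weightInd (negSet g) Y = 0 :=
    ind_eq_zero _ (posSet g) (fun χ => by simp [mem_posSet, mem_negSet]) Y hpos
  have hXY : weightInd (leviRootSet g) Y = weightInd (leviRootSet g) X := by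
    rw [← sub_eq_zero, ← map_sub]
    refine ind_eq_zero _ (leviRootSet g) (fun χ => by simp [mem_leviRootSet]) _ fun z => ?_
    rw [map_sub, LinearMap.sub_apply, hlevi, sub_self]
  have cartan_eq : ∀ (h' : H) (x : 𝔤), (∀ z : H, killingForm ℂ 𝔤 x z = killingForm ℂ 𝔤 (h' : 𝔤) z) →
      weightInd (H := H) {0} x = h' := by
    intro h' x hx
    refine eq_of_killingForm_eq fun z => ?_
    rw [killingForm_weightInd (A := {0}) (B := {0}) (by simp), ← coe_cartanPart, hx,
      killingForm_coe_left h' z]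
    rfl
  have hsum : weightInd (H := H) {0} (X + Y) = ((2 : ℂ) • η : H) := by
    refine cartan_eq _ _ fun z => ?_
    have := hcartan 0 z
    simp only [ZeroMemClass.coe_zero, map_zero, zero_add, zero_sub, map_neg] at this
    simp only [map_add, LinearMap.add_apply, SetLike.val_smul, map_smul, LinearMap.smul_apply,
      smul_eq_mul]
    linear_combination -this
  have hdiff : weightInd (H := H) {0} (X - Y) = ((2 : ℂ) • ξ : H) := by
    refine cartan_eq _ _ fun z => ?_
    have := hcartan z 0
    simp only [ZeroMemClass.coe_zero, map_zero, add_zero, sub_zero] at this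
    simp only [map_sub, LinearMap.sub_apply, SetLike.val_smul, map_smul, LinearMap.smul_apply,
      smul_eq_mul]
    linear_combination -this
  have hξ : weightInd (H := H) {0} X = weightInd (H := H) {0} (Y + (2 : ℂ) • (ξ : 𝔤)) := by
    rw [map_add, map_smul, weightInd_coe_of_mem (Set.mem_singleton 0)]
    rw [map_sub, SetLike.val_smul, sub_eq_iff_eq_add] at hdiff
    rw [hdiff, add_comm]
  have decomp : ∀ x : 𝔤, weightInd (nonposSet g) x + weightInd (posSet g) x = x := by
    intro x
    have : posSet g = (nonposSet g)ᶜ := by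
      ext χ
      rw [Set.mem_compl_iff, mem_posSet, mem_nonposSet, not_le]
    rw [this, weightInd_add_compl]
  have decomp' : ∀ x : 𝔤, weightInd (nonnegSet g) x + weightInd (negSet g) x = x := by
    intro x
    have : negSet g = (nonnegSet g)ᶜ := by
      ext χ
      rw [Set.mem_compl_iff, mem_negSet, mem_nonnegSet, not_le]
    rw [this, weightInd_add_compl]
  rw [mem_modelSpace]
  refine ⟨?_, ?_, ?_, ?_⟩
  · rw [weightInd_leviSet, weightInd_leviSet, hξ]
    congr 1
    rw [map_add, map_smul, weightInd_coe_of_notMem (fun h => h.1 rfl), smul_zero, add_zero]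
    exact hXY.symm
  · simpa [hX] using decomp X
  · have h0 : weightInd (negSet g) (Y + (2 : ℂ) • (ξ : 𝔤)) = 0 := by
      rw [map_add, hY, map_smul, weightInd_coe_of_notMem (by simp [mem_negSet]), smul_zero,
        add_zero]
    have := decomp' (Y + (2 : ℂ) • (ξ : 𝔤))
    rwa [h0, add_zero] at this
  · apply Subtype.ext
    have h1 := congrArg₂ (· + ·) hsum hdiff
    simp only [← map_add, SetLike.val_smul] at h1
    have h2 : X + Y + (X - Y) = (2 : ℂ) • X := by
      rw [two_smul]
      abel
    rw [h2, map_smul, ← smul_add] at h1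
    exact smul_right_injective 𝔤 (two_ne_zero' ℂ) h1

/-- The last component is the bracket of the shifted vectors `Y + 2ξ`, because the Cartan subalgebra
is abelian; Levi projection is a homomorphism on each parabolic. This expression is what remains of
the Courant bracket once derivatives are accounted for. -/
theorem modelSpace_bracket (g : H) {u v : Fiber H} (hu : u ∈ modelSpace g) (hv : v ∈ modelSpace g) :
    ((0, cartanPart H ⁅u.2.2.2, v.2.2.2⁆, ⁅u.2.2.1, v.2.2.1⁆,
      ⁅u.2.2.2, v.2.2.2⁆ + (2 : ℂ) • ⁅(u.1 : 𝔤), v.2.2.2⁆ - (2 : ℂ) • ⁅(v.1 : 𝔤), u.2.2.2⁆) :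
      Fiber H) ∈ modelSpace g := by
  obtain ⟨h1, h2, h3, h4⟩ := mem_modelSpace.mp hu
  obtain ⟨k1, k2, k3, k4⟩ := mem_modelSpace.mp hv
  have key : ⁅u.2.2.2, v.2.2.2⁆ + (2 : ℂ) • ⁅(u.1 : 𝔤), v.2.2.2⁆ - (2 : ℂ) • ⁅(v.1 : 𝔤), u.2.2.2⁆ =
      ⁅u.2.2.2 + (2 : ℂ) • (u.1 : 𝔤), v.2.2.2 + (2 : ℂ) • (v.1 : 𝔤)⁆ := by
    simp only [lie_add, add_lie, lie_smul, smul_lie, cartan_lie_eq_zero, smul_zero, add_zero]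
    rw [← lie_skew u.2.2.2 (v.1 : 𝔤), smul_neg]
    abel
  have hlevi : weightInd (leviSet g) ⁅u.2.2.1, v.2.2.1⁆ = weightInd (leviSet g)
      ⁅u.2.2.2 + (2 : ℂ) • (u.1 : 𝔤), v.2.2.2 + (2 : ℂ) • (v.1 : 𝔤)⁆ := by
    rw [weightInd_leviSet_lie_of_nonpos g h2 k2, weightInd_leviSet_lie_of_nonneg g h3 k3, h1, k1]
  have hc : cartanPart H ⁅u.2.2.2 + (2 : ℂ) • (u.1 : 𝔤), v.2.2.2 + (2 : ℂ) • (v.1 : 𝔤)⁆ =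
      cartanPart H ⁅u.2.2.2, v.2.2.2⁆ := by
    rw [← key, map_sub, map_add, map_smul, map_smul, cartanPart_lie_coe, cartanPart_lie_coe]
    simp
  rw [mem_modelSpace]
  simp only [ZeroMemClass.coe_zero, smul_zero, add_zero]
  rw [key]
  refine ⟨hlevi, ?_, ?_, ?_⟩
  · exact weightInd_lie_eq_self (fun χ hχ ψ hψ => by
      rw [mem_nonposSet] at *
      rw [Pi.add_apply, Complex.add_re]
      linarith) h2 k2
  · exact weightInd_lie_eq_self (fun χ hχ ψ hψ => by
      rw [mem_nonnegSet] at *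
      rw [Pi.add_apply, Complex.add_re]
      linarith) h3 k3
  · rw [← hc, ← cartanPart_weightInd (zero_mem_leviSet g), hlevi,
      cartanPart_weightInd (zero_mem_leviSet g)]

end Model

/-! ### The family `L` as a twist of the model. -/

section Family

variable {𝔤 : Type*} [LieRing 𝔤] [LieAlgebra ℂ 𝔤] [FiniteDimensional ℂ 𝔤] [LieAlgebra.IsSimple ℂ 𝔤]
  {H : LieSubalgebra ℂ 𝔤} [H.IsCartanSubalgebra] {b : (rootSystem H).Base} {S : Set H.root}
  {g : H} {φ : H → Module.End ℂ ↥(nPos b S ⊔ nNeg b S)} {μ : H}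

theorem mem_family_iff {u : Fiber H} : u ∈ family b S φ μ ↔
    ∃ (h k : H) (X : ↥(nPos b S ⊔ nNeg b S)), ∃ Ym ∈ kNeg b S, ∃ Yp ∈ kPos b S,
      u = (k, h, (h : 𝔤) + k + X + Ym, (h : 𝔤) - k + φ μ X + Yp) := by
  constructor
  · intro hu
    induction hu using Submodule.span_induction with
    | mem u hu =>
      rcases hu with (⟨h, k, rfl⟩ | ⟨X, rfl⟩) | ⟨Ym, hYm, Yp, hYp, rfl⟩
      · exact ⟨h, k, 0, 0, zero_mem _, 0, zero_mem _, by simp⟩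
      · exact ⟨0, 0, X, 0, zero_mem _, 0, zero_mem _, by simp⟩
      · exact ⟨0, 0, 0, Ym, hYm, Yp, hYp, by simp⟩
    | zero => exact ⟨0, 0, 0, 0, zero_mem _, 0, zero_mem _, by simp; rfl⟩
    | add u v _ _ hu hv =>
      obtain ⟨h, k, X, Ym, hYm, Yp, hYp, rfl⟩ := hu
      obtain ⟨h', k', X', Ym', hYm', Yp', hYp', rfl⟩ := hv
      refine ⟨h + h', k + k', X + X', Ym + Ym', add_mem hYm hYm', Yp + Yp', add_mem hYp hYp', ?_⟩
      simp only [Prod.mk_add_mk, map_add, AddMemClass.coe_add, Prod.mk.injEq, true_and]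
      constructor <;> abel
    | smul c u _ hu =>
      obtain ⟨h, k, X, Ym, hYm, Yp, hYp, rfl⟩ := hu
      refine ⟨c • h, c • k, c • X, c • Ym, Submodule.smul_mem _ _ hYm, c • Yp,
        Submodule.smul_mem _ _ hYp, ?_⟩
      simp only [Prod.smul_mk, map_smul, SetLike.val_smul, smul_add, smul_sub]
  · rintro ⟨h, k, X, Ym, hYm, Yp, hYp, rfl⟩
    have h1 : ((k, h, (h : 𝔤) + k, (h : 𝔤) - k) : Fiber H) ∈ family b S φ μ :=
      Submodule.subset_span (Or.inl (Or.inl ⟨h, k, rfl⟩))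
    have h2 : ((0, 0, (X : 𝔤), (φ μ X : 𝔤)) : Fiber H) ∈ family b S φ μ :=
      Submodule.subset_span (Or.inl (Or.inr ⟨X, rfl⟩))
    have h3 : ((0, 0, Ym, Yp) : Fiber H) ∈ family b S φ μ :=
      Submodule.subset_span (Or.inr ⟨Ym, hYm, Yp, hYp, rfl⟩)
    simpa using add_mem (add_mem h1 h2) h3

theorem IsGrading.mem_nPos_sup_nNeg (hg : IsGrading b S g) {x : 𝔤} :
    x ∈ nPos b S ⊔ nNeg b S ↔ weightInd (leviRootSet g) x = x := by
  rw [weightInd_eq_self_iff, hg.nPos_sup_nNeg_eq]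
  rfl

theorem IsGrading.mem_kPos (hg : IsGrading b S g) {x : 𝔤} :
    x ∈ kPos b S ↔ weightInd (posSet g) x = x := by
  rw [weightInd_eq_self_iff, hg.kPos_eq]
  rfl

theorem IsGrading.mem_kNeg (hg : IsGrading b S g) {x : 𝔤} :
    x ∈ kNeg b S ↔ weightInd (negSet g) x = x := by
  rw [weightInd_eq_self_iff, hg.kNeg_eq]
  rfl

theorem disjoint_negSet_leviSet (g : H) : Disjoint (negSet g) (leviSet g) :=
  Set.disjoint_left.mpr fun χ h1 h2 => by
    rw [mem_negSet] at h1
    rw [mem_leviSet] at h2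
    exact h1.ne h2

theorem disjoint_posSet_leviSet (g : H) : Disjoint (posSet g) (leviSet g) :=
  Set.disjoint_left.mpr fun χ h1 h2 => by
    rw [mem_posSet] at h1
    rw [mem_leviSet] at h2
    exact h1.ne' h2

theorem leviRootSet_subset_leviSet (g : H) : leviRootSet g ⊆ leviSet g := fun _ h => h.2

theorem weightInd_idem (A : Set (H → ℂ)) (x : 𝔤) : weightInd A (weightInd A x) = weightInd A x := by
  rw [weightInd_weightInd, Set.inter_self]

variable (H) in
/-- The action of `torus h` on the last component of the fibres. -/
def twist (h : H) : Fiber H →ₗ[ℂ] Fiber H :=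
  LinearMap.id.prodMap (LinearMap.id.prodMap (LinearMap.id.prodMap (torus h)))

theorem twist_apply (h : H) (u : Fiber H) :
    twist H h u = (u.1, u.2.1, u.2.2.1, torus h u.2.2.2) := rfl

theorem twist_neg_twist (h : H) (u : Fiber H) : twist H (-h) (twist H h u) = u := by
  simp only [twist_apply, torus_neg_torus]

theorem twist_twist_neg (h : H) (u : Fiber H) : twist H h (twist H (-h) u) = u := by
  simp only [twist_apply, torus_torus_neg]

theorem pairing_twist (h : H) (u v : Fiber H) :
    pairing H (twist H h u) (twist H h v) = pairing H u v := by
  simp only [pairing_apply, twist_apply, killingForm_torus]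

theorem IsGrading.family_eq (hg : IsGrading b S g) {h₀ : H}
    (hφ : ∀ X : ↥(nPos b S ⊔ nNeg b S), (φ μ X : 𝔤) = torus h₀ (X : 𝔤)) :
    family b S φ μ = (modelSpace g).comap (twist H (-h₀)) := by
  ext u
  rw [mem_family_iff, Submodule.mem_comap]
  constructor
  · rintro ⟨h, k, X, Ym, hYm, Yp, hYp, rfl⟩
    have hX := hg.mem_nPos_sup_nNeg.mp X.2
    rw [hg.mem_kNeg] at hYm
    rw [hg.mem_kPos] at hYp
    have hYp' : weightInd (posSet g) (torus (-h₀) Yp) = torus (-h₀) Yp := by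
      rw [← torus_weightInd, hYp]
    have e : torus (-h₀) ((h : 𝔤) - k + φ μ X + Yp) + (2 : ℂ) • (k : 𝔤) =
        h + k + X + torus (-h₀) Yp := by
      rw [map_add, map_add, map_sub, torus_coe, torus_coe, hφ, torus_neg_torus, two_smul]
      abel
    have h0 : (0 : H → ℂ) ∈ nonposSet g := by simp [mem_nonposSet]
    have h0' : (0 : H → ℂ) ∈ nonnegSet g := by simp [mem_nonnegSet]
    rw [mem_modelSpace, twist_apply]
    simp only [e]
    refine ⟨?_, ?_, ?_, ?_⟩
    · rw [map_add, map_add (weightInd (leviSet g)) _ (torus (-h₀) Yp),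
        weightInd_eq_zero_of_disjoint hYm (disjoint_negSet_leviSet g),
        weightInd_eq_zero_of_disjoint hYp' (disjoint_posSet_leviSet g)]
    · rw [map_add, map_add, map_add, weightInd_coe_of_mem h0, weightInd_coe_of_mem h0,
        weightInd_eq_self_of_subset (B := nonposSet g) hX (fun χ hχ => hχ.2.le),
        weightInd_eq_self_of_subset (B := nonposSet g) hYm (fun χ hχ => (mem_negSet.mp hχ).le)]
    · rw [map_add, map_add, map_add, weightInd_coe_of_mem h0', weightInd_coe_of_mem h0',
        weightInd_eq_self_of_subset (B := nonnegSet g) hX (fun χ hχ => hχ.2.ge),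
        weightInd_eq_self_of_subset (B := nonnegSet g) hYp' (fun χ hχ => (mem_posSet.mp hχ).le)]
    · have hX0 : cartanPart H (X : 𝔤) = 0 := Subtype.ext
        (weightInd_eq_zero_of_disjoint hX (Set.disjoint_singleton_right.mpr fun h => h.1 rfl))
      have hY0 : cartanPart H Ym = 0 := Subtype.ext
        (weightInd_eq_zero_of_disjoint hYm (Set.disjoint_singleton_right.mpr fun h => by
          rw [mem_negSet] at h
          simp at h))
      rw [map_add, map_add, map_add, hX0, hY0, cartanPart_coe, cartanPart_coe, add_zero, add_zero]
  · intro hu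
    obtain ⟨ξ, η, X, Y⟩ := u
    obtain ⟨h1, h2, h3, h4⟩ := mem_modelSpace.mp hu
    simp only [twist_apply] at h1 h2 h3 h4
    set Z := torus (-h₀) Y + (2 : ℂ) • (ξ : 𝔤) with hZ
    have hc : weightInd (H := H) {0} X = (η : 𝔤) + ξ := by
      rw [← coe_cartanPart, h4]
      rfl
    refine ⟨η, ξ, ⟨weightInd (leviRootSet g) X, hg.mem_nPos_sup_nNeg.mpr (weightInd_idem _ _)⟩,
      weightInd (negSet g) X, hg.mem_kNeg.mpr (weightInd_idem _ _),
      weightInd (posSet g) (torus h₀ Z), hg.mem_kPos.mpr (weightInd_idem _ _), ?_⟩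
    rw [hφ]
    have hXe : X = (η : 𝔤) + ξ + weightInd (leviRootSet g) X + weightInd (negSet g) X := by
      conv_lhs => rw [← h2, weightInd_nonposSet, weightInd_leviSet, hc]
    have hZe : Z = (η : 𝔤) + ξ + weightInd (leviRootSet g) X + weightInd (posSet g) Z := by
      conv_lhs => rw [← h3, weightInd_nonnegSet, ← h1, weightInd_leviSet, hc]
    have hY : Y = torus h₀ Z - (2 : ℂ) • (ξ : 𝔤) := by
      rw [hZ, map_add, torus_torus_neg, map_smul, torus_coe, add_sub_cancel_right]
    refine Prod.ext rfl (Prod.ext rfl (Prod.ext hXe ?_))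
    change Y = _
    rw [hY]
    conv_lhs => rw [hZe]
    rw [map_add, map_add, map_add, torus_coe, torus_coe, torus_weightInd h₀ (posSet g), two_smul]
    abel_nf

/-- The twist preserves the pairing, and the model contains its orthogonal; an isotropic `W` above
it is orthogonal to it, hence inside it. -/
theorem maximal_isIsotropic_comap (g h₀ : H) :
    Maximal IsIsotropic ((modelSpace g).comap (twist H (-h₀))) := by
  constructor
  · intro u hu v hv
    rw [← pairing_twist (-h₀)]
    exact modelSpace_isIsotropic g _ hu _ hv
  · intro W hW hle u hu
    refine mem_modelSpace_of_forall_pairing_eq_zero g fun v hv => ?_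
    rw [← pairing_twist h₀, twist_twist_neg]
    refine hW u hu _ (hle ?_)
    rwa [Submodule.mem_comap, twist_neg_twist]

theorem comap_modelSpace_bracket (g h₀ : H) {u v : Fiber H}
    (hu : u ∈ (modelSpace g).comap (twist H (-h₀)))
    (hv : v ∈ (modelSpace g).comap (twist H (-h₀))) :
    ((0, cartanPart H ⁅u.2.2.2, v.2.2.2⁆, ⁅u.2.2.1, v.2.2.1⁆,
      ⁅u.2.2.2, v.2.2.2⁆ + (2 : ℂ) • ⁅(u.1 : 𝔤), v.2.2.2⁆ - (2 : ℂ) • ⁅(v.1 : 𝔤), u.2.2.2⁆) :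
      Fiber H) ∈ (modelSpace g).comap (twist H (-h₀)) := by
  have := modelSpace_bracket g hu hv
  rw [Submodule.mem_comap]
  convert this using 1
  simp only [twist_apply, map_sub, map_add, map_smul, torus_lie, torus_coe]
  rw [← torus_lie, cartanPart_torus]

end Family

/-! ### Sufficiency: the twisted family is a Dirac structure. -/

section Sections

variable {𝔤 : Type*} [LieRing 𝔤] [LieAlgebra ℂ 𝔤] [FiniteDimensional ℂ 𝔤] [LieAlgebra.IsSimple ℂ 𝔤]
  {H : LieSubalgebra ℂ 𝔤} [H.IsCartanSubalgebra]
  [TopologicalSpace 𝔤] [IsTopologicalAddGroup 𝔤] [ContinuousSMul ℂ 𝔤] [T2Space 𝔤]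

instance : IsTopologicalAddGroup H := inferInstanceAs (IsTopologicalAddGroup H.toSubmodule)

instance : ContinuousSMul ℂ H := inferInstanceAs (ContinuousSMul ℂ H.toSubmodule)

theorem exists_hasFDerivAt_torus {a : H → H} {a' : H →L[ℂ] H} {y : H → 𝔤} {y' : H →L[ℂ] 𝔤} {μ : H}
    (ha : HasFDerivAt a a' μ) (hy : HasFDerivAt y y' μ) :
    ∃ f' : H →L[ℂ] 𝔤, HasFDerivAt (fun ν => torus (a ν) (y ν)) f' μ ∧
      ∀ v, f' v = torus (a μ) (y' v) + ⁅(a' v : 𝔤), torus (a μ) (y μ)⁆ := by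
  let := finNormedAddCommGroup H
  let := finNormedAddCommGroup 𝔤
  let := finNormedSpace H
  let := finNormedSpace 𝔤
  let ℓ : LieModule.Weight ℂ H 𝔤 → (H →L[ℂ] ℂ) := fun χ => χ.toLinear.toContinuousLinearMap
  let P : LieModule.Weight ℂ H 𝔤 → (𝔤 →L[ℂ] 𝔤) := fun χ =>
    LinearMap.toContinuousLinearMap (weightProj H χ)
  have h1 : ∀ χ : LieModule.Weight ℂ H 𝔤, HasFDerivAt (fun ν => Complex.exp (ℓ χ (a ν)))
      (Complex.exp (ℓ χ (a μ)) • (ℓ χ ∘L a')) μ := fun χ =>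
    ((ℓ χ).hasFDerivAt.comp μ ha).cexp
  have h2 : ∀ χ : LieModule.Weight ℂ H 𝔤, HasFDerivAt (fun ν => P χ (y ν)) (P χ ∘L y') μ :=
    fun χ => (P χ).hasFDerivAt.comp μ hy
  have h3 := HasFDerivAt.fun_sum (u := Finset.univ) fun χ _ => (h1 χ).smul (h2 χ)
  refine ⟨_, h3.congr_of_eventuallyEq (Filter.Eventually.of_forall fun ν => ?_), fun v => ?_⟩
  · simp only [torus, weightMul, LinearMap.sum_apply, LinearMap.smul_apply]
    rfl
  · rw [← weightMul_eval, torus, weightMul_mul_apply, weightMul, weightMul]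
    simp only [sum_apply, LinearMap.sum_apply, LinearMap.smul_apply,
      ← Finset.sum_add_distrib]
    refine Finset.sum_congr rfl fun χ _ => ?_
    simp only [add_apply, smul_apply,
      ContinuousLinearMap.comp_apply, ContinuousLinearMap.smulRight_apply, smul_eq_mul]
    congr 2
    exact mul_comm _ _

variable {U : Set H} {L : H → Submodule ℂ (Fiber H)} {g μ₀ : H}

theorem hasFDerivAt_const_smul_add (c : ℂ) (μ₀ μ : H) :
    HasFDerivAt (fun ν : H => c • (ν + μ₀)) (c • ContinuousLinearMap.id ℂ H) μ := by
  let := finNormedAddCommGroup H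
  let := finNormedSpace H
  exact ((hasFDerivAt_id μ).add_const μ₀).const_smul c

theorem exists_hasFDerivAt_twist {a : H → H} {a' : H →L[ℂ] H} {s : H → Fiber H}
    {s' : H →L[ℂ] Fiber H} {μ : H} (ha : HasFDerivAt a a' μ) (hs : HasFDerivAt s s' μ) :
    ∃ f' : H →L[ℂ] Fiber H, HasFDerivAt (fun ν => twist H (a ν) (s ν)) f' μ ∧
      ∀ v, f' v = twist H (a μ) (s' v) + (0, 0, 0, ⁅(a' v : 𝔤), torus (a μ) (s μ).2.2.2⁆) := by
  let := finNormedAddCommGroup H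
  let := finNormedAddCommGroup 𝔤
  let := finNormedSpace H
  let := finNormedSpace 𝔤
  obtain ⟨f', hf, hf'⟩ := exists_hasFDerivAt_torus ha (hs.snd.snd.snd)
  refine ⟨_, hs.fst.prodMk (hs.snd.fst.prodMk (hs.snd.snd.fst.prodMk hf)), fun v => ?_⟩
  simp only [ContinuousLinearMap.prod_apply, hf']
  simp [twist_apply]

theorem isSection_hasFDerivAt (hU : IsOpen U) {s : H → Fiber H} (hs : IsSection U L s) {μ : H}
    (hμ : μ ∈ U) : HasFDerivAt s (fderiv ℂ s μ) μ := by
  let := finNormedAddCommGroup H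
  let := finNormedAddCommGroup 𝔤
  let := finNormedSpace H
  let := finNormedSpace 𝔤
  exact ((hs.1 μ hμ).differentiableAt (hU.mem_nhds hμ)).hasFDerivAt

/-- The family obtained from `modelSpace g` by moving the last component with
`Ad (exp (2 (μ + μ₀)))`. -/
def modelFamily (g μ₀ : H) (μ : H) : Submodule ℂ (Fiber H) :=
  (modelSpace g).comap (twist H (-((2 : ℂ) • (μ + μ₀))))

/-- Untwisting `s` gives a function with values in the fixed space `modelSpace g`, whose derivatives
stay there. The correction is the derivative of `Ad e^{-2(μ+μ₀)}`. -/
theorem fderiv_section_sub_mem (hU : IsOpen U) {s : H → Fiber H}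
    (hs : IsSection U (modelFamily g μ₀) s) {μ : H} (hμ : μ ∈ U) (v : H) :
    fderiv ℂ s μ v - (0, 0, 0, (2 : ℂ) • ⁅(v : 𝔤), (s μ).2.2.2⁆) ∈ modelFamily g μ₀ μ := by
  obtain ⟨f', hf, hf'⟩ := exists_hasFDerivAt_twist (hasFDerivAt_const_smul_add (-2) μ₀ μ)
    (isSection_hasFDerivAt hU hs hμ)
  have h1 : ∀ ν : H, (-2 : ℂ) • (ν + μ₀) = -((2 : ℂ) • (ν + μ₀)) := fun ν => neg_smul _ _
  have h2 := mem_of_hasFDerivAt_of_eventually_mem hf (W := modelSpace g) (by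
    filter_upwards [hU.mem_nhds hμ] with ν hν
    rw [h1]
    exact hs.2 ν hν) v
  rw [hf', h1] at h2
  rw [modelFamily, Submodule.mem_comap]
  convert h2 using 1
  rw [map_sub, sub_eq_add_neg]
  congr 1
  simp only [twist_apply, map_smul, torus_lie, torus_coe]
  ext <;> simp

/-- Modulo `L`, `∂_v s` is `(0, 0, 0, 2[v, Y])`. By isotropy each term of `ω` contributes half of
`⟨[Y₁, Y₂], v⟩`, so `ω` is the Cartan part of `[Y₁, Y₂]`, as `comap_modelSpace_bracket` requires. -/
theorem modelFamily_bracket_mem (hU : IsOpen U) {s t : H → Fiber H}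
    (hs : IsSection U (modelFamily g μ₀) s) (ht : IsSection U (modelFamily g μ₀) t) {μ : H}
    (hμ : μ ∈ U) : courantBracket s t μ ∈ modelFamily g μ₀ μ := by
  have ds := fderiv_section_sub_mem hU hs hμ
  have dt := fderiv_section_sub_mem hU ht hμ
  have hiso := (maximal_isIsotropic_comap g ((2 : ℂ) • (μ + μ₀))).1
  have hω : (cartanEquivDual H).symm
      ((pairing H).flip (t μ) ∘ₗ (fderiv ℂ s μ : H →ₗ[ℂ] Fiber H) -
        pairing H (s μ) ∘ₗ (fderiv ℂ t μ : H →ₗ[ℂ] Fiber H)) =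
      cartanPart H ⁅(s μ).2.2.2, (t μ).2.2.2⁆ := by
    refine cartanEquivDual_symm_eq fun v => ?_
    have e1 := hiso _ (ds v) _ (ht.2 μ hμ)
    have e2 := hiso _ (hs.2 μ hμ) _ (dt v)
    rw [map_sub, LinearMap.sub_apply, sub_eq_zero] at e1
    rw [map_sub, sub_eq_zero] at e2
    simp only [LinearMap.sub_apply, LinearMap.comp_apply, LinearMap.BilinForm.flip_apply,
      ContinuousLinearMap.coe_coe]
    rw [e1, e2, pairing_apply, pairing_apply]
    simp only [ZeroMemClass.coe_zero, map_zero, LinearMap.zero_apply, map_smul,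
      LinearMap.smul_apply, smul_eq_mul]
    rw [killingForm_lie, killingForm_comm (v : 𝔤), ← lie_skew (v : 𝔤) (t μ).2.2.2, map_neg,
      ← killingForm_lie]
    ring
  have key := comap_modelSpace_bracket g _ (hs.2 μ hμ) (ht.2 μ hμ)
  have := add_mem (sub_mem (dt (s μ).1) (ds (t μ).1)) key
  convert this using 1
  rw [courantBracket, hω]
  simp only [sub_eq_add_neg, Prod.neg_mk, neg_zero]
  ext <;> simp
  abel

theorem isHolomorphicSubbundle_modelFamily (hU : IsOpen U) :
    IsHolomorphicSubbundle U (modelFamily g μ₀) := by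
  intro μ hμ
  let B := Module.finBasis ℂ (modelSpace g)
  refine ⟨U, hU, hμ, subset_rfl, Module.finrank ℂ (modelSpace g),
    fun i ν => twist H ((2 : ℂ) • (ν + μ₀)) (B i), fun i ν hν => ?_, fun ν hν => ⟨?_, ?_⟩⟩
  · obtain ⟨f', hf, -⟩ := exists_hasFDerivAt_twist (hasFDerivAt_const_smul_add 2 μ₀ ν)
      (hasFDerivAt_const (B i : Fiber H) ν)
    exact hf.differentiableAt.differentiableWithinAt
  · have hli : LinearIndependent ℂ fun i => (B i : Fiber H) :=
      B.linearIndependent.map' (modelSpace g).subtype (Submodule.ker_subtype _)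
    exact hli.map' (twist H ((2 : ℂ) • (ν + μ₀))) (LinearMap.ker_eq_bot.mpr
      (Function.LeftInverse.injective (twist_neg_twist _)))
  · have h1 : (Set.range fun i => twist H ((2 : ℂ) • (ν + μ₀)) (B i)) =
        twist H ((2 : ℂ) • (ν + μ₀)) '' (modelSpace g).subtype '' Set.range B := by
      rw [← Set.range_comp, ← Set.range_comp]
      rfl
    rw [h1, ← Submodule.map_span, ← Submodule.map_span, B.span_eq, Submodule.map_top,
      Submodule.range_subtype]
    ext u
    rw [Submodule.mem_map, modelFamily, Submodule.mem_comap]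
    constructor
    · rintro ⟨w, hw, rfl⟩
      rwa [twist_neg_twist]
    · intro hu
      exact ⟨_, hu, twist_twist_neg _ _⟩

theorem isDirac_modelFamily (hU : IsOpen U) : IsDirac U (modelFamily g μ₀) where
  subbundle := isHolomorphicSubbundle_modelFamily hU
  maximal_isotropic _ _ := maximal_isIsotropic_comap _ _
  bracket_closed _ _ hs ht _ hμ := modelFamily_bracket_mem hU hs ht hμ

/-- Needed because `φ` is arbitrary outside `U`. -/
theorem IsDirac.congr {L' : H → Submodule ℂ (Fiber H)} (h : IsDirac U L)
    (hL : ∀ μ ∈ U, L' μ = L μ) : IsDirac U L' where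
  subbundle μ hμ := by
    obtain ⟨V, hV, hμV, hVU, r, e, he, he'⟩ := h.subbundle μ hμ
    exact ⟨V, hV, hμV, hVU, r, e, he, fun ν hν => by rw [hL ν (hVU hν)]; exact he' ν hν⟩
  maximal_isotropic μ hμ := by
    rw [hL μ hμ]
    exact h.maximal_isotropic μ hμ
  bracket_closed s t hs ht μ hμ := by
    rw [hL μ hμ]
    exact h.bracket_closed s t ⟨hs.1, fun ν hν => by rw [← hL ν hν]; exact hs.2 ν hν⟩
      ⟨ht.1, fun ν hν => by rw [← hL ν hν]; exact ht.2 ν hν⟩ μ hμ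

end Sections

/-! ### Operators on the Levi root spaces that come from the torus. -/

section Rigidity

variable {𝔤 : Type*} [LieRing 𝔤] [LieAlgebra ℂ 𝔤] [FiniteDimensional ℂ 𝔤] [LieAlgebra.IsSimple ℂ 𝔤]
  {H : LieSubalgebra ℂ 𝔤} [H.IsCartanSubalgebra] {b : (rootSystem H).Base} {S : Set H.root}
  {g : H}

theorem weightInd_of_mem_rootSpace {A : Set (H → ℂ)} {χ : H → ℂ} (hχ : χ ∈ A) {x : 𝔤}
    (hx : x ∈ rootSpace H χ) : weightInd A x = x := by
  rw [weightInd, weightMul_apply_of_mem _ hx, Set.indicator_of_mem hχ, Pi.one_apply, one_smul]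

/-- The properties of an operator on `𝔫°₊ ⊕ 𝔫°₋`, extended by zero to `𝔤`, that make it a
restriction of `Ad (exp h)`. -/
structure IsLeviAutomorphism (g : H) (T : Module.End ℂ 𝔤) : Prop where
  lie_coe : ∀ (h : H) (x : 𝔤), weightInd (leviRootSet g) x = x → T ⁅(h : 𝔤), x⁆ = ⁅(h : 𝔤), T x⁆
  lie : ∀ x y : 𝔤, weightInd (leviRootSet g) x = x → weightInd (leviRootSet g) y = y →
    weightInd (leviRootSet g) ⁅T x, T y⁆ = T ⁅x, y⁆
  killingForm : ∀ x y : 𝔤, weightInd (leviRootSet g) x = x → weightInd (leviRootSet g) y = y →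
    killingForm ℂ 𝔤 (T x) (T y) = killingForm ℂ 𝔤 x y

namespace IsLeviAutomorphism

variable {T : Module.End ℂ 𝔤}

theorem mem_rootSpace (hT : IsLeviAutomorphism g T) {χ : H → ℂ} (hχ : χ ∈ leviRootSet g) {x : 𝔤}
    (hx : x ∈ rootSpace H χ) : T x ∈ rootSpace H χ := by
  refine LieModule.weightSpace_le_genWeightSpace 𝔤 χ ?_
  rw [LieModule.mem_weightSpace]
  intro h
  have := hT.lie_coe h x (weightInd_of_mem_rootSpace hχ hx)
  rw [← LieSubalgebra.coe_bracket_of_module, lie_eq_smul_of_mem_rootSpace hx, map_smul] at this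
  exact this.symm

/-- An isometry is injective where the form is nondegenerate, as it is here because `leviRootSet g`
is stable under negation. -/
theorem eq_zero (hT : IsLeviAutomorphism g T) {x : 𝔤} (hx : weightInd (leviRootSet g) x = x)
    (h : T x = 0) : x = 0 := by
  refine eq_of_killingForm_eq fun z => ?_
  rw [← hx, killingForm_weightInd (B := leviRootSet g) (fun χ => by simp [mem_leviRootSet]),
    ← hT.killingForm _ _ hx (weightInd_idem _ _), h]
  simp

theorem exists_eigenvalue (hT : IsLeviAutomorphism g T) (α : H.root)
    (hα : ((α : LieModule.Weight ℂ H 𝔤) g).re = 0) : ∃ c : ℂ, c ≠ 0 ∧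
      ∀ x ∈ rootSpace H (α : LieModule.Weight ℂ H 𝔤), T x = c • x := by
  have hα0 := H.isNonZero_coe_root α
  have hmem : ⇑(α : LieModule.Weight ℂ H 𝔤) ∈ leviRootSet g := ⟨hα0, hα⟩
  obtain ⟨e, he, he0⟩ := (α : LieModule.Weight ℂ H 𝔤).exists_ne_zero
  obtain ⟨c, hc⟩ := exists_smul_eq_of_mem_rootSpace hα0 he he0 (hT.mem_rootSpace hmem he)
  refine ⟨c, ?_, fun x hx => ?_⟩
  · rintro rfl
    rw [zero_smul] at hc
    exact he0 (hT.eq_zero (weightInd_of_mem_rootSpace hmem he) hc.symm)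
  · obtain ⟨d, rfl⟩ := exists_smul_eq_of_mem_rootSpace hα0 he he0 hx
    rw [map_smul, ← hc, smul_comm]

/-- Logarithms of the eigenvalues on simple root spaces determine `h`. A nonsimple positive root of
degree 0 is a sum of a positive root and a simple root, both of degree 0; the bracket of their root
spaces is nonzero, so it fills a one-dimensional root space on which `T` is then forced. -/
theorem exists_eq_torus_of_isPos (hT : IsLeviAutomorphism g T) (hg : IsGrading b S g) :
    ∃ h : H, ∀ α : H.root, b.IsPos α → ((α : LieModule.Weight ℂ H 𝔤) g).re = 0 →
      ∀ x ∈ rootSpace H (α : LieModule.Weight ℂ H 𝔤), T x = torus h x := by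
  have hex : ∀ α : H.root, ∃ c : ℂ, ((α : LieModule.Weight ℂ H 𝔤) g).re = 0 → c ≠ 0 ∧
      ∀ x ∈ rootSpace H (α : LieModule.Weight ℂ H 𝔤), T x = c • x := by
    intro α
    by_cases hα : ((α : LieModule.Weight ℂ H 𝔤) g).re = 0
    · obtain ⟨c, hc⟩ := hT.exists_eigenvalue α hα
      exact ⟨c, fun _ => hc⟩
    · exact ⟨0, fun h => absurd h hα⟩
  choose c hc using hex
  obtain ⟨h, hh⟩ := exists_forall_simple_apply_eq b fun α => Complex.log (c α)
  have simple : ∀ i ∈ b.support, ((i : LieModule.Weight ℂ H 𝔤) g).re = 0 →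
      ∀ x ∈ rootSpace H (i : LieModule.Weight ℂ H 𝔤), T x = torus h x := by
    intro i hi hi0 x hx
    rw [torus_apply_of_mem h hx, hh i hi, Complex.exp_log (hc i hi0).1]
    exact (hc i hi0).2 x hx
  refine ⟨h, fun α hα => (hα.induction_on_add (p := fun α : H.root => b.IsPos α ∧
    (((α : LieModule.Weight ℂ H 𝔤) g).re = 0 →
      ∀ x ∈ rootSpace H (α : LieModule.Weight ℂ H 𝔤), T x = torus h x))
    (fun i hi => ⟨RootPairing.Base.isPos_of_mem_support hi, simple i hi⟩)
    (fun i j k hk hi hj => ?_)).2⟩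
  have hjp := RootPairing.Base.isPos_of_mem_support hj
  refine ⟨hi.1.add hjp hk, fun hk0 z hz => ?_⟩
  have hk0' := hk0
  rw [weight_apply_eq_add hk, Complex.add_re] at hk0'
  have h1 := hg.re_nonneg i hi.1
  have h2 := hg.re_nonneg j hjp
  have hi0 : ((i : LieModule.Weight ℂ H 𝔤) g).re = 0 := by linarith
  have hj0 : ((j : LieModule.Weight ℂ H 𝔤) g).re = 0 := by linarith
  have hkw : ⇑(k : LieModule.Weight ℂ H 𝔤) =
      ⇑(j : LieModule.Weight ℂ H 𝔤) + ⇑(i : LieModule.Weight ℂ H 𝔤) := by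
    ext v
    rw [Pi.add_apply, weight_apply_eq_add hk, add_comm]
  obtain ⟨x, hx, y, hy, hxy⟩ := exists_lie_ne_zero (H.isNonZero_coe_root j) hkw
  have hxyk : ⁅x, y⁆ ∈ rootSpace H (k : LieModule.Weight ℂ H 𝔤) := by
    rw [hkw]
    exact lie_mem_genWeightSpace_of_mem_genWeightSpace hx hy
  have hT' : T ⁅x, y⁆ = torus h ⁅x, y⁆ := by
    have := hT.lie x y
      (weightInd_of_mem_rootSpace (A := leviRootSet g)
        (mem_leviRootSet.mpr ⟨H.isNonZero_coe_root j, hj0⟩) hx)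
      (weightInd_of_mem_rootSpace (A := leviRootSet g)
        (mem_leviRootSet.mpr ⟨H.isNonZero_coe_root i, hi0⟩) hy)
    rw [← this, simple j hj hj0 x hx, hi.2 hi0 y hy, ← torus_lie, ← torus_weightInd,
      weightInd_of_mem_rootSpace (A := leviRootSet g)
        (mem_leviRootSet.mpr ⟨H.isNonZero_coe_root k, hk0⟩) hxyk]
  obtain ⟨d, rfl⟩ := exists_smul_eq_of_mem_rootSpace (H.isNonZero_coe_root k) hxyk hxy hz
  rw [map_smul, map_smul, hT']

theorem exists_eq_torus (hT : IsLeviAutomorphism g T) (hg : IsGrading b S g) :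
    ∃ h : H, ∀ x : 𝔤, weightInd (leviRootSet g) x = x → T x = torus h x := by
  obtain ⟨h, hh⟩ := hT.exists_eq_torus_of_isPos hg
  refine ⟨h, fun x hx => ?_⟩
  suffices hle : (⨆ χ ∈ leviRootSet g, (rootSpace H χ).toSubmodule) ≤ LinearMap.ker (T - torus h) by
    rw [weightInd_eq_self_iff] at hx
    simpa [sub_eq_zero] using hle hx
  refine iSup₂_le fun χ hχ x hx => ?_
  rw [LinearMap.mem_ker, LinearMap.sub_apply, sub_eq_zero]
  replace hx : x ∈ rootSpace H χ := hx
  by_cases hbot : rootSpace H χ = ⊥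
  · rw [hbot, LieSubmodule.mem_bot] at hx
    simp [hx]
  obtain ⟨α, hα, rfl | rfl⟩ := exists_isPos_eq_or_eq_neg b hχ.1 hbot
  · exact hh α hα hχ.2 x hx
  · have hα0 : ((α : LieModule.Weight ℂ H 𝔤) g).re = 0 := by simpa using hχ.2
    -- On a negative root space invariance of the Killing form decides: `T x - torus h x` is
    -- orthogonal to the root space of `α`, where `T` is already known.
    have hd : T x - torus h x ∈ rootSpace H (-⇑(α : LieModule.Weight ℂ H 𝔤)) := by
      refine sub_mem (hT.mem_rootSpace hχ hx) ?_
      rw [torus_apply_of_mem h hx]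
      exact Submodule.smul_mem _ _ hx
    have hker := mem_ker_killingForm_of_mem_rootSpace_of_forall_rootSpace_neg ℂ 𝔤 H hd
      fun y hy => by
        rw [neg_neg] at hy
        have h1 := hT.killingForm x y (weightInd_of_mem_rootSpace hχ hx)
          (weightInd_of_mem_rootSpace (A := leviRootSet g)
            (mem_leviRootSet.mpr ⟨H.isNonZero_coe_root α, hα0⟩) hy)
        rw [hh α hα hα0 y hy, ← killingForm_torus h x y, torus_apply_of_mem h hy, map_smul,
          map_smul] at h1
        rw [map_sub, LinearMap.sub_apply, sub_eq_zero]
        exact smul_right_injective ℂ (Complex.exp_ne_zero _) h1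
    rw [ker_killingForm_eq_bot, Submodule.mem_bot, sub_eq_zero] at hker
    exact hker

end IsLeviAutomorphism

end Rigidity

/-! ### Necessity: the equations imposed on `φ`. -/

section Necessity

variable {𝔤 : Type*} [LieRing 𝔤] [LieAlgebra ℂ 𝔤] [FiniteDimensional ℂ 𝔤] [LieAlgebra.IsSimple ℂ 𝔤]
  {H : LieSubalgebra ℂ 𝔤} [H.IsCartanSubalgebra] {b : (rootSystem H).Base} {S : Set H.root}
  {g : H} {φ : H → Module.End ℂ ↥(nPos b S ⊔ nNeg b S)} {μ : H}

/-- The extension by zero of an operator on `𝔫°₊ ⊕ 𝔫°₋` to `𝔤`. -/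
def leviExtend (hg : IsGrading b S g) (θ : Module.End ℂ ↥(nPos b S ⊔ nNeg b S)) :
    Module.End ℂ 𝔤 :=
  (nPos b S ⊔ nNeg b S).subtype ∘ₗ θ ∘ₗ (weightInd (leviRootSet g)).codRestrict _
    (fun _ => hg.mem_nPos_sup_nNeg.mpr (weightInd_idem _ _))

theorem leviExtend_eq (hg : IsGrading b S g) (θ : Module.End ℂ ↥(nPos b S ⊔ nNeg b S)) {x : 𝔤}
    {X : ↥(nPos b S ⊔ nNeg b S)} (h : weightInd (leviRootSet g) x = X) :
    leviExtend hg θ x = θ X := by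
  have : (weightInd (leviRootSet g)).codRestrict (nPos b S ⊔ nNeg b S)
    (fun _ => hg.mem_nPos_sup_nNeg.mpr (weightInd_idem _ _)) x = X := Subtype.ext h
  simp [leviExtend, this]

theorem leviExtend_coe (hg : IsGrading b S g) (θ : Module.End ℂ ↥(nPos b S ⊔ nNeg b S))
    (X : ↥(nPos b S ⊔ nNeg b S)) : leviExtend hg θ (X : 𝔤) = θ X :=
  leviExtend_eq hg θ (hg.mem_nPos_sup_nNeg.mp X.2)

/-- All the bracket equations for `φ` come from this consequence of membership. It sees only the
last two components, so `ω` never has to be computed for necessity. -/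
theorem weightInd_of_mem_family (hg : IsGrading b S g) {u : Fiber H} (hu : u ∈ family b S φ μ) :
    weightInd (leviRootSet g) u.2.2.2 = leviExtend hg (φ μ) u.2.2.1 := by
  obtain ⟨h, k, X, Ym, hYm, Yp, hYp, rfl⟩ := mem_family_iff.mp hu
  have h1 : ∀ v : H, weightInd (leviRootSet g) (v : 𝔤) = 0 :=
    weightInd_coe_of_notMem fun h => h.1 rfl
  have h2 := weightInd_eq_zero_of_disjoint (hg.mem_kNeg.mp hYm)
    ((disjoint_negSet_leviSet g).mono_right (leviRootSet_subset_leviSet g))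
  have h3 := weightInd_eq_zero_of_disjoint (hg.mem_kPos.mp hYp)
    ((disjoint_posSet_leviSet g).mono_right (leviRootSet_subset_leviSet g))
  have h4 := hg.mem_nPos_sup_nNeg.mp (φ μ X).2
  rw [leviExtend_eq hg (φ μ) (X := X)]
  · simp only [map_add, map_sub, h1, h3, h4, sub_zero, zero_add, add_zero]
  · simp only [map_add, h1, h2, hg.mem_nPos_sup_nNeg.mp X.2, zero_add, add_zero]

variable [TopologicalSpace 𝔤] [IsTopologicalAddGroup 𝔤] [ContinuousSMul ℂ 𝔤] [T2Space 𝔤] {U : Set H}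

/-- No regularity of `φ` is assumed; it is extracted from a holomorphic frame of `L` by
`differentiableAt_of_mem_span`. -/
theorem differentiableAt_of_isHolomorphicSubbundle (hg : IsGrading b S g)
    (hL : IsHolomorphicSubbundle U (family b S φ)) (hμ : μ ∈ U) (X : ↥(nPos b S ⊔ nNeg b S)) :
    DifferentiableAt ℂ (fun ν => (φ ν X : 𝔤)) μ := by
  let := finNormedAddCommGroup H
  let := finNormedAddCommGroup 𝔤
  let := finNormedSpace H
  let := finNormedSpace 𝔤
  obtain ⟨V, hV, hμV, -, r, e, he, he'⟩ := hL μ hμ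
  -- `p` keeps only the positive part of `Y`. It is injective on `L(μ)`, where `ξ`, `η`, `X`
  -- determine the rest of `Y`, and it sends `(0, 0, X, φ X)` to a constant.
  let p : Fiber H →ₗ[ℂ] Fiber H :=
    LinearMap.id.prodMap (LinearMap.id.prodMap (LinearMap.id.prodMap (weightInd (posSet g))))
  have hp : ∀ u, p u = (u.1, u.2.1, u.2.2.1, weightInd (posSet g) u.2.2.2) := fun _ => rfl
  have hlevi : ∀ Z : ↥(nPos b S ⊔ nNeg b S), weightInd (posSet g) (Z : 𝔤) = 0 := fun Z =>
    weightInd_eq_zero_of_disjoint (hg.mem_nPos_sup_nNeg.mp Z.2)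
      ((disjoint_posSet_leviSet g).symm.mono_left (leviRootSet_subset_leviSet g))
  have key : DifferentiableAt ℂ (fun ν => ((0, 0, (X : 𝔤), (φ ν X : 𝔤)) : Fiber H)) μ := by
    refine differentiableAt_of_mem_span (e := e) (q := (0, 0, (X : 𝔤), 0))
      (fun i => (he i).differentiableAt (hV.mem_nhds hμV)) p ?_ ?_ ?_
    · refine (he' μ hμV).1.map (f := p) ?_
      rw [(he' μ hμV).2, Submodule.disjoint_def]
      intro u hu hpu
      obtain ⟨h, k, Z, Ym, hYm, Yp, hYp, rfl⟩ := mem_family_iff.mp hu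
      rw [LinearMap.mem_ker, hp] at hpu
      simp only [Prod.mk_eq_zero] at hpu
      obtain ⟨rfl, rfl, h3, h4⟩ := hpu
      have hZ := hg.mem_nPos_sup_nNeg.mp Z.2
      have hYm0 := weightInd_eq_zero_of_disjoint (hg.mem_kNeg.mp hYm)
        ((disjoint_negSet_leviSet g).mono_right (leviRootSet_subset_leviSet g))
      simp only [ZeroMemClass.coe_zero, add_zero, sub_zero, zero_add] at h3 h4
      have hZ0 : Z = 0 := by
        have := congrArg (weightInd (leviRootSet g)) h3
        rw [map_add, hZ, hYm0, add_zero, map_zero] at this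
        exact Subtype.ext this
      rw [map_add, hlevi, zero_add, hg.mem_kPos.mp hYp] at h4
      subst hZ0
      simp only [ZeroMemClass.coe_zero, zero_add] at h3
      simp [h3, h4]
    · filter_upwards [hV.mem_nhds hμV] with ν hν
      rw [(he' ν hν).2, mem_family_iff]
      exact ⟨0, 0, X, 0, zero_mem _, 0, zero_mem _, by simp⟩
    · refine Filter.Eventually.of_forall fun ν => ?_
      rw [hp, hlevi]
  exact key.snd.snd.snd

theorem killingForm_of_isIsotropic (hL : IsIsotropic (family b S φ μ))
    (X X' : ↥(nPos b S ⊔ nNeg b S)) :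
    killingForm ℂ 𝔤 (φ μ X : 𝔤) (φ μ X') = killingForm ℂ 𝔤 (X : 𝔤) X' := by
  have := hL (0, 0, (X : 𝔤), (φ μ X : 𝔤)) (Submodule.subset_span (Or.inl (Or.inr ⟨X, rfl⟩)))
    (0, 0, (X' : 𝔤), (φ μ X' : 𝔤)) (Submodule.subset_span (Or.inl (Or.inr ⟨X', rfl⟩)))
  rw [pairing_apply] at this
  simp only [ZeroMemClass.coe_zero, map_zero, add_zero, mul_zero, zero_add] at this
  linear_combination 4 * this

theorem isSection_levi (hg : IsGrading b S g) (hL : IsHolomorphicSubbundle U (family b S φ))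
    (X : ↥(nPos b S ⊔ nNeg b S)) :
    IsSection U (family b S φ) fun ν => (0, 0, (X : 𝔤), (φ ν X : 𝔤)) := by
  refine ⟨fun μ hμ => ?_, fun ν _ => Submodule.subset_span (Or.inl (Or.inr ⟨X, rfl⟩))⟩
  let := finNormedAddCommGroup H
  let := finNormedAddCommGroup 𝔤
  let := finNormedSpace H
  let := finNormedSpace 𝔤
  have h := differentiableAt_of_isHolomorphicSubbundle hg hL hμ X
  exact ((differentiableAt_const (0 : H)).prodMk ((differentiableAt_const (0 : H)).prodMk
    ((differentiableAt_const (X : 𝔤)).prodMk h))).differentiableWithinAt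

theorem fderiv_section_levi {y : H → 𝔤} {y' : H →L[ℂ] 𝔤} (hy : HasFDerivAt y y' μ) (x : 𝔤) (v : H) :
    fderiv ℂ (fun ν => ((0, 0, x, y ν) : Fiber H)) μ v = (0, 0, 0, y' v) := by
  let := finNormedAddCommGroup H
  let := finNormedAddCommGroup 𝔤
  let := finNormedSpace H
  let := finNormedSpace 𝔤
  have h : HasFDerivAt (fun ν => ((0, 0, x, y ν) : Fiber H)) _ μ :=
    (hasFDerivAt_const (0 : H) μ).prodMk ((hasFDerivAt_const (0 : H) μ).prodMk
      ((hasFDerivAt_const x μ).prodMk hy))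
  rw [h.fderiv]
  rfl

theorem IsDirac.bracket_cartan (hg : IsGrading b S g) (hL : IsDirac U (family b S φ)) (hμ : μ ∈ U)
    (X : ↥(nPos b S ⊔ nNeg b S)) (h k : H) :
    weightInd (leviRootSet g) (fderiv ℂ (fun ν => (φ ν X : 𝔤)) μ k + ⁅(h : 𝔤) - k, (φ μ X : 𝔤)⁆) =
      leviExtend hg (φ μ) ⁅(h : 𝔤) + k, (X : 𝔤)⁆ := by
  let := finNormedAddCommGroup H
  let := finNormedAddCommGroup 𝔤
  let := finNormedSpace H
  let := finNormedSpace 𝔤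
  have hy := (differentiableAt_of_isHolomorphicSubbundle hg hL.subbundle hμ X).hasFDerivAt
  have hs : IsSection U (family b S φ) fun _ => (k, h, (h : 𝔤) + k, (h : 𝔤) - k) :=
    ⟨differentiableOn_const _, fun _ _ => Submodule.subset_span (Or.inl (Or.inl ⟨h, k, rfl⟩))⟩
  have := weightInd_of_mem_family hg
    (hL.bracket_closed _ _ hs (isSection_levi hg hL.subbundle X) μ hμ)
  simp only [courantBracket, fderiv_section_levi hy, fderiv_const_apply] at this
  simpa using this

theorem IsDirac.bracket_levi (hg : IsGrading b S g) (hL : IsDirac U (family b S φ)) (hμ : μ ∈ U)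
    (X X' : ↥(nPos b S ⊔ nNeg b S)) :
    weightInd (leviRootSet g) ⁅(φ μ X : 𝔤), (φ μ X' : 𝔤)⁆ =
      leviExtend hg (φ μ) ⁅(X : 𝔤), (X' : 𝔤)⁆ := by
  have := weightInd_of_mem_family hg (hL.bracket_closed _ _
    (isSection_levi hg hL.subbundle X) (isSection_levi hg hL.subbundle X') μ hμ)
  simp only [courantBracket, map_zero] at this
  simpa using this

theorem weightInd_lie_coe (A : Set (H → ℂ)) (h : H) (x : 𝔤) :
    weightInd A ⁅(h : 𝔤), x⁆ = ⁅(h : 𝔤), weightInd A x⁆ := by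
  rw [← weightMul_eval, ← weightMul_weightInd_comm, weightMul_eval]

theorem IsDirac.lie_coe (hg : IsGrading b S g) (hL : IsDirac U (family b S φ)) (hμ : μ ∈ U)
    (X : ↥(nPos b S ⊔ nNeg b S)) (h : H) :
    leviExtend hg (φ μ) ⁅(h : 𝔤), (X : 𝔤)⁆ = ⁅(h : 𝔤), (φ μ X : 𝔤)⁆ := by
  have := IsDirac.bracket_cartan hg hL hμ X h 0
  rw [map_zero, ZeroMemClass.coe_zero, zero_add, sub_zero, add_zero, weightInd_lie_coe,
    hg.mem_nPos_sup_nNeg.mp (φ μ X).2] at this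
  exact this.symm

/-- `bracket_cartan` with `h = 0` gives `∂_k φX - [k, φX] = φ[k, X]`, and the right side is `[k,
φX]`, whence the factor 2. The projection disappears because `φX`, hence its derivative, stays in
`𝔫°₊ ⊕ 𝔫°₋`. -/
theorem IsDirac.fderiv_eq (hg : IsGrading b S g) (hL : IsDirac U (family b S φ)) (hμ : μ ∈ U)
    (X : ↥(nPos b S ⊔ nNeg b S)) (k : H) :
    fderiv ℂ (fun ν => (φ ν X : 𝔤)) μ k = (2 : ℂ) • ⁅(k : 𝔤), (φ μ X : 𝔤)⁆ := by
  have h1 := IsDirac.bracket_cartan hg hL hμ X 0 k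
  have hmem := mem_of_hasFDerivAt_of_eventually_mem
    (f := fun ν => (φ ν X : 𝔤)) (f' := fderiv ℂ (fun ν => (φ ν X : 𝔤)) μ) (x := μ)
    (W := nPos b S ⊔ nNeg b S) (by
      let := finNormedAddCommGroup H
      let := finNormedAddCommGroup 𝔤
      let := finNormedSpace H
      let := finNormedSpace 𝔤
      exact (differentiableAt_of_isHolomorphicSubbundle hg hL.subbundle hμ X).hasFDerivAt)
    (Filter.Eventually.of_forall fun ν => (φ ν X).2) k
  rw [ZeroMemClass.coe_zero, zero_add, zero_sub, neg_lie, map_add, map_neg, weightInd_lie_coe,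
    hg.mem_nPos_sup_nNeg.mp (φ μ X).2, hg.mem_nPos_sup_nNeg.mp hmem,
    IsDirac.lie_coe hg hL hμ, ← sub_eq_add_neg, sub_eq_iff_eq_add] at h1
  rw [h1, two_smul]

theorem IsDirac.isLeviAutomorphism (hg : IsGrading b S g) (hL : IsDirac U (family b S φ))
    (hμ : μ ∈ U) : IsLeviAutomorphism g (leviExtend hg (φ μ)) where
  lie_coe h x hx := by
    lift x to ↥(nPos b S ⊔ nNeg b S) using hg.mem_nPos_sup_nNeg.mpr hx
    rw [leviExtend_coe, IsDirac.lie_coe hg hL hμ]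
  lie x y hx hy := by
    lift x to ↥(nPos b S ⊔ nNeg b S) using hg.mem_nPos_sup_nNeg.mpr hx
    lift y to ↥(nPos b S ⊔ nNeg b S) using hg.mem_nPos_sup_nNeg.mpr hy
    rw [leviExtend_coe, leviExtend_coe, IsDirac.bracket_levi hg hL hμ]
  killingForm x y hx hy := by
    lift x to ↥(nPos b S ⊔ nNeg b S) using hg.mem_nPos_sup_nNeg.mpr hx
    lift y to ↥(nPos b S ⊔ nNeg b S) using hg.mem_nPos_sup_nNeg.mpr hy
    rw [leviExtend_coe, leviExtend_coe,
      killingForm_of_isIsotropic (hL.maximal_isotropic μ hμ).1]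

/-- The derivative of `Ad e^{-2μ}` cancels the term `2[k, φX]`. The summand `0` matches the form of
`hasFDerivAt_const_smul_add`. -/
theorem IsDirac.torus_eq (hg : IsGrading b S g) (hL : IsDirac U (family b S φ)) (hUo : IsOpen U)
    (hUc : IsPreconnected U) (X : ↥(nPos b S ⊔ nNeg b S)) {μ ν : H} (hμ : μ ∈ U) (hν : ν ∈ U) :
    torus ((-2 : ℂ) • (μ + 0)) (φ μ X : 𝔤) = torus ((-2 : ℂ) • (ν + 0)) (φ ν X : 𝔤) := by
  refine eq_of_hasFDerivAt_zero (f := fun ν : H => torus ((-2 : ℂ) • (ν + 0)) (φ ν X : 𝔤))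
    hUo hUc (fun κ hκ => ?_) hμ hν
  obtain ⟨f', hf, hf'⟩ := exists_hasFDerivAt_torus (hasFDerivAt_const_smul_add (-2) 0 κ)
    (y := fun ν => (φ ν X : 𝔤)) (y' := fderiv ℂ (fun ν => (φ ν X : 𝔤)) κ) (by
      let := finNormedAddCommGroup H
      let := finNormedAddCommGroup 𝔤
      let := finNormedSpace H
      let := finNormedSpace 𝔤
      exact (differentiableAt_of_isHolomorphicSubbundle hg hL.subbundle hκ X).hasFDerivAt)
  convert hf using 1
  ext v
  rw [hf', IsDirac.fderiv_eq hg hL hκ, map_smul, torus_lie, torus_coe]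
  simp

theorem IsDirac.exists_eq_torus (hg : IsGrading b S g) (hL : IsDirac U (family b S φ))
    (hUo : IsOpen U) (hUc : IsConnected U) :
    ∃ μ₀ : H, ∀ μ ∈ U, ∀ X : ↥(nPos b S ⊔ nNeg b S),
      (φ μ X : 𝔤) = torus ((2 : ℂ) • (μ + μ₀)) (X : 𝔤) := by
  obtain ⟨ν, hν⟩ := hUc.nonempty
  obtain ⟨h, hh⟩ := (IsDirac.isLeviAutomorphism hg hL hν).exists_eq_torus hg
  -- From `φ(ν) = Ad e^h` and constancy, `φ(μ) = Ad e^{2μ - 2ν + h}`, and the exponent must be `2(μ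
  -- + μ₀)`.
  refine ⟨(1 / 2 : ℂ) • h - ν, fun μ hμ X => ?_⟩
  have h1 := IsDirac.torus_eq hg hL hUo hUc.isPreconnected X hμ hν
  rw [← leviExtend_coe hg (φ ν), hh X (hg.mem_nPos_sup_nNeg.mp X.2), torus_torus] at h1
  have h2 := congrArg (torus (-((-2 : ℂ) • (μ + 0)))) h1
  rw [torus_neg_torus, torus_torus] at h2
  rw [h2]
  congr 2
  module

end Necessity

end

end DiracTriangular

theorem theorem4p5 {𝔤 : Type*} [LieRing 𝔤] [LieAlgebra ℂ 𝔤] [FiniteDimensional ℂ 𝔤]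
    [LieAlgebra.IsSimple ℂ 𝔤]
    -- the canonical topology of the finite-dimensional vector space `𝔤`
    [TopologicalSpace 𝔤] [IsTopologicalAddGroup 𝔤] [ContinuousSMul ℂ 𝔤] [T2Space 𝔤]
    (H : LieSubalgebra ℂ 𝔤) [H.IsCartanSubalgebra]
    (b : (LieAlgebra.IsKilling.rootSystem H).Base)
    (S : Set H.root) (hS : S ⊆ (b.support : Set H.root))
    (U : Set H) (hUo : IsOpen U) (hUc : IsConnected U)
    (φ : H → Module.End ℂ
      ↥(DiracTriangular.nPos b S ⊔ DiracTriangular.nNeg b S)) :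
    DiracTriangular.IsDirac U (DiracTriangular.family b S φ) ↔
      -- `φ(μ)` is the restriction of `Ad (exp (2 (μ + μ₀))) = exp (ad (2 (μ + μ₀)))`
      ∃ μ₀ : H, ∀ μ ∈ U, ∀ X : ↥(DiracTriangular.nPos b S ⊔ DiracTriangular.nNeg b S),
        HasSum
          (fun n : ℕ => ((n.factorial : ℂ)⁻¹) •
            ((LieAlgebra.ad ℂ 𝔤 ((2 : ℂ) • ((μ : 𝔤) + (μ₀ : 𝔤)))) ^ n) (X : 𝔤))
          (φ μ X : 𝔤) := by
  obtain ⟨g, hg⟩ := DiracTriangular.exists_isGrading b S hS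
  constructor
  · intro hL
    obtain ⟨μ₀, h⟩ := DiracTriangular.IsDirac.exists_eq_torus hg hL hUo hUc
    refine ⟨μ₀, fun μ hμ X => ?_⟩
    rw [h μ hμ X]
    exact DiracTriangular.hasSum_torus ((2 : ℂ) • (μ + μ₀)) (X : 𝔤)
  · rintro ⟨μ₀, h⟩
    refine (DiracTriangular.isDirac_modelFamily (g := g) (μ₀ := μ₀) hUo).congr fun μ hμ => ?_
    exact hg.family_eq fun X =>
      (h μ hμ X).unique (DiracTriangular.hasSum_torus ((2 : ℂ) • (μ + μ₀)) (X : 𝔤))
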